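/- **Proposition 3.3 (one-box associativity).** Let $0<k<n$ be integers. For $N\ge k$ let $\mathcal P_{kN}$ be the set of partitions $\lambda=(N-k\ge\lambda_1\ge\dots\ge\lambda_k\ge 0)$, let $\Lambda_N=\mathbb Z[t_1,\dots,t_N]$, and let $$s_\lambda(x|t)=\sum_T\prod_{\alpha\in T}\bigl(x_{T(\alpha)}-t_{T(\alpha)+c(\alpha)}\bigr)$$ be the factorial Schur polynomial in $x_1,\dots,x_k$: the sum is over semistandard tableaux $T$ of shape $\lambda$ with entries in $\{1,\dots,k\}$, the box $\alpha$ in row $i$ and column $j$ has content $c(\alpha)=j-i$, and $t_i=0$ for $i>N$. Put $e_i(x|t)=s_{(1)^i}(x|t)$ and $h_i(x|t)=s_{(i)}(x|t)$. The equivariant cohomology ring of the Grassmannian is presented as $$H^*_{T_N}(Gr(k,N))=\Lambda_N[e_1(x|t),\dots,e_k(x|t)]/\langle h_{N-k+1}(x|t),\dots,h_N(x|t)\rangle ,$$ where the Schubert class $\sigma_\lambda$ ($\lambda\in\mathcal P_{kN}$) is the class of $s_\lambda(x|t)$. Let $A$ be the free $\Lambda_n[q]$-module with basis $\{\sigma_\lambda:\lambda\in\mathcal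 P_{kn}\}$. An $n$-rim hook of a partition is a connected set of $n$ boxes of its Young diagram that contains no $2\times2$ square and whose removal leaves a partition; its height is the number of rows it meets. Define the reduction map $\varphi$ on coefficients as the ring homomorphism $\Lambda_{2n-1}\to\Lambda_n$ with $t_i\mapsto t_{i \bmod n}$ (representatives $1,\dots,n$), and on Schubert classes $\sigma_\gamma$, $\gamma\in\mathcal P_{k,2n-1}$, as follows: remove $n$-rim hooks from $\gamma$, of heights $\varepsilon_1,\dots,\varepsilon_d$, until the $n$-core $\nu$ of $\gamma$, which has no $n$-rim hook, is reached, and put $$\varphi(\sigma_\gamma)=\begin{cases}\prod_{i=1}^d\bigl((-1)^{\varepsilon_i-k}q\bigr)\,\sigma_\nu&\text{if }\nu\in\mathcal P_{kn},\\0&\text{if }\nu\notin\mathcal P_{kn}.\end{cases}$$ For $\lambda,\mu\in\mathcal P_{kn}$ regard $\lambda,\mu$ as elements of $\mathcal P_{k,2n-1}$, write $\widehat{\sigma_\lambda}\cdot\widehat{\sigma_\mu}=\sum_{\gamma\in\mathcal P_{k,2n-1}}c_{\lambda,\mu}^\gamma\,\sigma_\gamma$ in $H^*_{T_{2n-1}}(Gr(k,2n-1))$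 with $c_{\lambda,\mu}^\gamma\in\Lambda_{2n-1}$, and set $$\sigma_\lambda\circ\sigma_\mu=\varphi(\widehat{\sigma_\lambda}\cdot\widehat{\sigma_\mu})=\sum_{\gamma\in\mathcal P_{k,2n-1}}\varphi(c_{\lambda,\mu}^\gamma)\,\varphi(\sigma_\gamma)\in A,$$ extended $\Lambda_n[q]$-bilinearly to a product $\circ$ on $A$. Then this product is well defined: the product of any two Schubert classes of $H^*_{T_{2n-1}}(Gr(k,2n-1))$ has exactly one expansion with coefficients in $\Lambda_{2n-1}$ in the classes $\sigma_\gamma$, $\gamma\in\mathcal P_{k,2n-1}$, and $\varphi(\sigma_\gamma)$ does not depend on the order in which the rim hooks are removed. Moreover, for all $\lambda,\mu\in\mathcal P_{kn}$, with $\square=(1)$ the one-box partition, $$(\sigma_\square\circ\sigma_\lambda)\circ\sigma_\mu=\sigma_\square\circ(\sigma_\lambda\circ\sigma_\mu).$$ -/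

import Mathlib

namespace GrassRimHook

noncomputable section

/-! ### Partitions in a box -/

/-- The set `P_{kN}` of partitions `N - k ≥ p 0 ≥ p 1 ≥ ⋯ ≥ p (k-1) ≥ 0`
(rows are indexed from `0`; used for `k ≤ N`). -/
def BoxPartition (k N : ℕ) : Type :=
  {p : Fin k → ℕ // Antitone p ∧ ∀ i, p i ≤ N - k}

instance (k N : ℕ) : Finite (BoxPartition k N) :=
  Finite.of_injective
    (fun (p : BoxPartition k N) (i : Fin k) =>
      (⟨p.1 i, Nat.lt_succ_of_le (p.2.2 i)⟩ : Fin (N - k + 1)))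
    (fun _ _ h => Subtype.ext (funext fun i => congrArg Fin.val (congrFun h i)))

instance (k N : ℕ) : Fintype (BoxPartition k N) := Fintype.ofFinite _

instance (k N : ℕ) : DecidableEq (BoxPartition k N) := Classical.decEq _

/-- The partition `(m)` with one row of `m` boxes. -/
def rowShape (k m : ℕ) : Fin k → ℕ := fun i => if i.val = 0 then m else 0

/-- The partition `(1)^m` with one column of `m` boxes. -/
def colShape (k m : ℕ) : Fin k → ℕ := fun i => if i.val < m then 1 else 0

/-- The one-box partition, as an element of `P_{kn}` for `k < n`. -/
def box {k n : ℕ} (hkn : k < n) : BoxPartition k n :=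
  ⟨rowShape k 1, by
    constructor
    · intro i j hij
      have h : i.val ≤ j.val := hij
      unfold rowShape
      split_ifs <;> omega
    · intro i
      unfold rowShape
      split_ifs <;> omega⟩

/-- A partition in `P_{kn}`, regarded as an element of `P_{k,2n-1}`. -/
def BoxPartition.lift {k n : ℕ} (p : BoxPartition k n) : BoxPartition k (2 * n - 1) :=
  ⟨p.1, p.2.1, fun i => (p.2.2 i).trans (by omega)⟩

/-! ### Factorial Schur polynomials -/

/-- `Λ_N = ℤ[t₁, …, t_N]`, where `t_{i+1}` is the variable with index `i : Fin N`. -/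
abbrev TorusRing (N : ℕ) : Type := MvPolynomial (Fin N) ℤ

/-- `Λ_N[x₁, …, x_k]`, where `x_{i+1}` is the variable with index `i : Fin k`. -/
abbrev PolyRing (k N : ℕ) : Type := MvPolynomial (Fin k) (TorusRing N)

/-- The torus weight `t_{i+1}`, for `i < N`; weights with index beyond `N` are set to `0`. -/
def weight (N i : ℕ) : TorusRing N := if h : i < N then MvPolynomial.X ⟨i, h⟩ else 0

/-- A filling of the boxes of `p` by `1, …, k` (here `0, …, k - 1`); `T i j` is the entry of the
box in row `i` and column `j`. -/
abbrev Filling {k : ℕ} (p : Fin k → ℕ) : Type := (i : Fin k) → Fin (p i) → Fin k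

/-- Semistandard: rows weakly increasing, columns strictly increasing. -/
def IsSemistandard {k : ℕ} (p : Fin k → ℕ) (T : Filling p) : Prop :=
  (∀ i, Monotone (T i)) ∧
  ∀ (i i' : Fin k) (j : ℕ) (h : j < p i) (h' : j < p i'), i < i' → T i ⟨j, h⟩ < T i' ⟨j, h'⟩

open Classical in
/-- The factorial Schur polynomial `s_p(x|t) = ∑_T ∏_α (x_{T(α)} - t_{T(α)+c(α)})`, with
`c(α) = j - i` for the box `α` in row `i` and column `j`. In a semistandard `T` every entry of
row `i` is at least `i`, so the subtraction of natural numbers is not truncated. -/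
def factorialSchur {k : ℕ} (N : ℕ) (p : Fin k → ℕ) : PolyRing k N :=
  ∑ T : Filling p with IsSemistandard p T, ∏ i : Fin k, ∏ j : Fin (p i),
    (MvPolynomial.X (T i j) - MvPolynomial.C (weight N ((T i j).val + j.val - i.val)))

/-- `e_m(x|t) = s_{(1)^m}(x|t)`. -/
def factorialE (k N m : ℕ) : PolyRing k N := factorialSchur N (colShape k m)

/-- `h_m(x|t) = s_{(m)}(x|t)`. -/
def factorialH (k N m : ℕ) : PolyRing k N := factorialSchur N (rowShape k m)

/-! ### Equivariant cohomology `H^*_{T_N}(Gr(k,N))` -/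

/-- The ring `Λ_N[e₁(x|t), …, e_k(x|t)]`. -/
def symRing (k N : ℕ) : Subalgebra (TorusRing N) (PolyRing k N) :=
  Algebra.adjoin (TorusRing N) {f | ∃ m, 1 ≤ m ∧ m ≤ k ∧ f = factorialE k N m}

/-- The ideal `⟨h_{N-k+1}(x|t), …, h_N(x|t)⟩` of `Λ_N[e₁(x|t), …, e_k(x|t)]`, as a set of
polynomials: all combinations of these `h_m(x|t)` with coefficients in that ring. -/
def relIdeal (k N : ℕ) : Submodule (symRing k N) (PolyRing k N) :=
  Submodule.span (symRing k N) {f | ∃ m, N - k + 1 ≤ m ∧ m ≤ N ∧ f = factorialH k N m}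

/-- The family `c` expands the product of the Schubert classes `σ_a` and `σ_b` in
`H^*_{T_N}(Gr(k,N)) = Λ_N[e₁(x|t), …, e_k(x|t)] / ⟨h_{N-k+1}(x|t), …, h_N(x|t)⟩`,
where `σ_a` is the class of `s_a(x|t)`. -/
def IsProductExpansion {k N : ℕ} (a b : BoxPartition k N)
    (c : BoxPartition k N → TorusRing N) : Prop :=
  factorialSchur N a.1 * factorialSchur N b.1 -
    ∑ g : BoxPartition k N, c g • factorialSchur N g.1 ∈ relIdeal k N

/-- The equivariant Littlewood-Richardson coefficients `g ↦ c_{a,b}^g`: the family that expands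
`σ_a · σ_b` in the Schubert basis of `H^*_{T_N}(Gr(k,N))`. -/
def structureConst {k N : ℕ} (a b : BoxPartition k N) : BoxPartition k N → TorusRing N :=
  Classical.epsilon (IsProductExpansion a b)

/-! ### Rim hooks -/

/-- `q` arises from `p` by removing an `n`-rim hook of height `e`, in rows `r, …, s`. In row `i`
with `r ≤ i < s` the boxes in columns `p_{i+1}, …, p_i` (columns counted from `1`) are removed, so
that consecutive rows of the hook share exactly one column; in row `s` as many boxes are removed
as are needed for a total of `n`, and what is left has to be a partition. -/
def RemovesRimHook {k : ℕ} (n : ℕ) (p q : Fin k → ℕ) (e : ℕ) : Prop :=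
  Antitone q ∧ ∃ r s : Fin k, r ≤ s ∧ e = s.val - r.val + 1 ∧
    (∀ i, i < r ∨ s < i → q i = p i) ∧
    (∀ i j : Fin k, r ≤ i → j ≤ s → j.val = i.val + 1 → q i + 1 = p j) ∧
    q s + n + r.val = p r + s.val

/-- `q` arises from `p` by successively removing `n`-rim hooks with the listed heights. -/
inductive RimHookReduces {k : ℕ} (n : ℕ) : (Fin k → ℕ) → List ℕ → (Fin k → ℕ) → Prop
  | nil (p : Fin k → ℕ) : RimHookReduces n p [] p
  | cons {p p' q : Fin k → ℕ} {e : ℕ} {es : List ℕ} :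
      RemovesRimHook n p p' e → RimHookReduces n p' es q → RimHookReduces n p (e :: es) q

/-- No `n`-rim hook can be removed from `p`. -/
def IsCore {k : ℕ} (n : ℕ) (p : Fin k → ℕ) : Prop := ¬ ∃ q e, RemovesRimHook n p q e

/-! ### The reduction map and the product -/

/-- The free module over `Λ_n[q] = ℤ[t₁, …, t_n][q]` with basis the Schubert classes indexed by
`P_{kn}`; the variable of `Polynomial` is `q`. -/
abbrev QModule (k n : ℕ) : Type := BoxPartition k n → Polynomial (TorusRing n)

/-- The basis element `σ_p`. -/
def schubert {k n : ℕ} (p : BoxPartition k n) : QModule k n := Pi.single p 1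

open Classical in
/-- `σ_p` if `p` lies in `P_{kn}`, and `0` otherwise. -/
def schubertOrZero {k : ℕ} (n : ℕ) (p : Fin k → ℕ) : QModule k n :=
  if h : Antitone p ∧ ∀ i, p i ≤ n - k then schubert ⟨p, h⟩ else 0

/-- `v` is the image of `σ_g` under rim hook reduction: `g` reduces to its `n`-core `p` by removing
`n`-rim hooks of heights `e₁, …, e_d`, and `v = ∏ᵢ ((-1)^(eᵢ - k) q) σ_p` if `p ∈ P_{kn}`, and
`v = 0` otherwise. Signs are written with exponent `eᵢ + k`, of the same parity as `eᵢ - k`. -/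
def IsRimHookImage {k : ℕ} (n : ℕ) (g : Fin k → ℕ) (v : QModule k n) : Prop :=
  ∃ (es : List ℕ) (p : Fin k → ℕ), RimHookReduces n g es p ∧ IsCore n p ∧
    v = (es.map fun e => (-1 : Polynomial (TorusRing n)) ^ (e + k) * Polynomial.X).prod •
      schubertOrZero n p

/-- The reduction map `φ` on Schubert classes. -/
def phiClass {k : ℕ} (n : ℕ) (g : Fin k → ℕ) : QModule k n :=
  Classical.epsilon (IsRimHookImage n g)

/-- The reduction map `φ` on coefficients: `t_i ↦ t_{i mod n}`, with representatives `1, …, n`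
(`0, …, n - 1` for the indices used here). -/
def phiCoeff (n : ℕ) : TorusRing (2 * n - 1) →+* Polynomial (TorusRing n) :=
  Polynomial.C.comp
    (MvPolynomial.rename fun i : Fin (2 * n - 1) =>
      (⟨i.val % n, Nat.mod_lt _ (by have := i.isLt; omega)⟩ : Fin n)).toRingHom

/-- The product of two basis elements: `σ_a ∘ σ_b = φ(σ̂_a · σ̂_b) = ∑_g φ(c_{a,b}^g) φ(σ_g)`, with
the product of the lifts taken in `H^*_{T_{2n-1}}(Gr(k,2n-1))`. -/
def circBasis {k n : ℕ} (a b : BoxPartition k n) : QModule k n :=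
  ∑ g : BoxPartition k (2 * n - 1), phiCoeff n (structureConst a.lift b.lift g) • phiClass n g.1

/-- The product `∘`, extended `Λ_n[q]`-bilinearly. -/
def circ {k n : ℕ} (u v : QModule k n) : QModule k n :=
  ∑ a : BoxPartition k n, ∑ b : BoxPartition k n, (u a * v b) • circBasis a b

end

end GrassRimHook

/-!
The product `∘` is multiplication in the ring of symmetric polynomials, acting on alternants modulo
the relations `(x_i|t)^n = (-1)^{k-1} q`. This makes it associative for arbitrary factors.

Write `(x|t)^m = (x - t₁)⋯(x - t_m)`. By the bialternant formula (`tabSum_mul_alternant`, proved by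
the branching rule for tableaux and column operations on the determinant), the factorial Schur
polynomial `s_λ(x|t)` times the Vandermonde alternant is the alternant `det ((x_i|t)^{β_j})`, where
`β_j = λ_j + k - j` are the beta numbers of `λ`.

*Existence and uniqueness of expansions.* Alternants with beta numbers below `N` are linearly
independent modulo a monic polynomial of degree `N` in each variable
(`eq_zero_of_sum_alternant_mem`), and every relation, multiplied by the Vandermonde alternant, lies
in the ideal of the `(x_i|t)^N`; this gives uniqueness. Antisymmetrization expands every symmetric
polynomial in factorial Schur polynomials (`exists_eq_sum_tabSum`). Those outside the box lie in the
span of the relations: `(Y - x₁)⋯(Y - x_k)` has coefficients in `Λ_N[e₁(x|t), …, e_k(x|t)]`, modulo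
it `s_λ(x|t)` becomes a determinant of coefficients of the remainders of the `(Y|t)^{β_j}`, and the
coefficients of the remainder of `(Y|t)^N` lie in the ideal of the `h_m(x|t)`.

*Rim hooks.* Removing an `n`-rim hook subtracts `n` from one beta number and moves it past `ε - 1`
others. With the periodic weights `t_{i mod n}` one has `(x|t)^{m+n} = (x|t)^n (x|t)^m`, so modulo
`(x_i|t)^n = (-1)^{k-1} q` the alternant changes exactly by the factor `(-1)^{ε-k} q`. In a core
outside the box two beta numbers differ by `n`, so two columns of its alternant are proportional and
it vanishes. Hence the alternant of `γ` is congruent to that of `φ(σ_γ)`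
(`IsRimHookImage.alternantClass_eq`), and by linear independence this determines `φ(σ_γ)`.

*Associativity.* For `λ, μ` in the small box the degree of `s_λ s_μ` in each variable is so small
that its expansion holds in the polynomial ring, without any relation
(`tabSum_mul_tabSum_eq_sum`). Reducing it modulo `(x_i|t)^n = (-1)^{k-1} q` shows that `∘` is induced
by multiplication of polynomials (`alternantClass_circ`).
-/

namespace GrassRimHook

open Finset

/-! ### Factorial powers and alternants -/

section Alternant

variable {R : Type*} [CommRing R]

/-- The factorial power `(x|w)^m = (x - w₀)(x - w₁)⋯(x - w_{m-1})`. -/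
def facPow (w : ℕ → R) (x : R) (m : ℕ) : R := ∏ i ∈ range m, (x - w i)

/-- The alternant `det ((x_i|w)^{b_j})`. -/
def alternant {k : ℕ} (x : Fin k → R) (w : ℕ → R) (b : Fin k → ℕ) : R :=
  (Matrix.of fun i j => facPow w (x i) (b j)).det

/-- The strictly decreasing sequence `p_i + (k - 1 - i)` of beta numbers of a partition `p`. -/
def betaNumber {k : ℕ} (p : Fin k → ℕ) (i : Fin k) : ℕ := p i + (k - 1 - i.val)

@[simp] lemma facPow_zero (w : ℕ → R) (x : R) : facPow w x 0 = 1 := by simp [facPow]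

lemma facPow_succ (w : ℕ → R) (x : R) (m : ℕ) :
    facPow w x (m + 1) = facPow w x m * (x - w m) := prod_range_succ _ _

lemma facPow_mul_prod_Ico (w : ℕ → R) (y : R) {a b : ℕ} (h : a ≤ b) :
    facPow w y a * ∏ l ∈ Ico a b, (y - w l) = facPow w y b :=
  prod_range_mul_prod_Ico _ h

lemma facPow_sub_facPow_mul (w : ℕ → R) (x y : R) {a b : ℕ} (h : a ≤ b) :
    facPow w x b - facPow w x a * ∏ l ∈ Ico a b, (y - w l) =
      (x - y) * ∑ c ∈ Ico a b, facPow w x c * ∏ l ∈ Ico (c + 1) b, (y - w l) := by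
  induction b, h using Nat.le_induction with
  | base => simp
  | succ b hab ih =>
    have h1 : ∑ c ∈ Ico a b, facPow w x c * ∏ l ∈ Ico (c + 1) (b + 1), (y - w l) =
        (∑ c ∈ Ico a b, facPow w x c * ∏ l ∈ Ico (c + 1) b, (y - w l)) * (y - w b) := by
      rw [sum_mul]
      refine sum_congr rfl fun c hc => ?_
      rw [prod_Ico_succ_top (by have := (mem_Ico.1 hc).2; omega), mul_assoc]
    rw [sum_Ico_succ_top hab, h1, prod_Ico_succ_top hab, facPow_succ, Ico_self, prod_empty]
    linear_combination (y - w b) * ih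

lemma det_eq_of_forall_col_eq_add_smul_next {k : ℕ} {A B : Matrix (Fin (k + 1)) (Fin (k + 1)) R}
    (c : Fin k → R) (hlast : ∀ i, A i (Fin.last k) = B i (Fin.last k))
    (hcast : ∀ i (j : Fin k), A i j.castSucc = B i j.castSucc + c j * A i j.succ) :
    A.det = B.det := by
  rw [← Matrix.det_submatrix_equiv_self Fin.revPerm A,
    ← Matrix.det_submatrix_equiv_self Fin.revPerm B]
  refine Matrix.det_eq_of_forall_col_eq_smul_add_pred (fun j => c j.rev) ?_ ?_
  · intro i
    simpa using hlast _
  · intro i j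
    simpa [Fin.rev_succ, Fin.rev_castSucc] using hcast i.rev j.rev

lemma det_col_sum {k : ℕ} (x : Fin k → R) (w : ℕ → R) (s : Fin k → Finset ℕ) (q : Fin k → ℕ → R) :
    (Matrix.of fun i j => ∑ c ∈ s j, facPow w (x i) c * q j c).det =
      ∑ c ∈ Fintype.piFinset s, (∏ j, q j (c j)) * alternant x w c := by
  have h := (Matrix.detRowAlternating (n := Fin k) (R := R)).toMultilinearMap.map_sum_finset
    (fun j c => fun i => q j c * facPow w (x i) c) s
  rw [← Matrix.det_transpose]
  have e : (Matrix.of fun i j => ∑ c ∈ s j, facPow w (x i) c * q j c).transpose =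
      fun j => ∑ c ∈ s j, fun i => q j c * facPow w (x i) c := by
    ext j i
    simp [mul_comm]
  rw [e]
  refine h.trans (sum_congr rfl fun c _ => ?_)
  rw [alternant, ← Matrix.det_transpose]
  exact Matrix.det_mul_column (fun j => q j (c j)) (Matrix.of fun j i => facPow w (x i) (c j))

/-- Clearing the last row of an alternant by column operations expands it in alternants in one
variable less, over exponents interlacing the given ones. -/
lemma alternant_succ {k : ℕ} (x : Fin (k + 1) → R) (w : ℕ → R) (b : Fin (k + 1) → ℕ)
    (hb : ∀ j : Fin k, b j.succ ≤ b j.castSucc) :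
    alternant x w b = facPow w (x (Fin.last k)) (b (Fin.last k)) *
      (∏ i : Fin k, (x i.castSucc - x (Fin.last k))) *
      ∑ c ∈ Fintype.piFinset fun j : Fin k => Ico (b j.succ) (b j.castSucc),
        (∏ j : Fin k, ∏ l ∈ Ico (c j + 1) (b j.castSucc), (x (Fin.last k) - w l)) *
          alternant (fun i => x i.castSucc) w c := by
  set y := x (Fin.last k) with hy
  let q : Fin k → R := fun j => ∏ l ∈ Ico (b j.succ) (b j.castSucc), (y - w l)
  let B : Matrix (Fin (k + 1)) (Fin (k + 1)) R := Matrix.of fun i =>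
    Fin.snoc (α := fun _ => R)
      (fun j : Fin k => facPow w (x i) (b j.castSucc) - facPow w (x i) (b j.succ) * q j)
      (facPow w (x i) (b (Fin.last k)))
  have h1 : alternant x w b = B.det := by
    refine det_eq_of_forall_col_eq_add_smul_next q ?_ ?_
    · intro i
      simp [B]
    · intro i j
      simp [B]
      ring
  have h0 : ∀ j : Fin k, B (Fin.last k) j.castSucc = 0 := by
    intro j
    simp only [B, Matrix.of_apply, Fin.snoc_castSucc, ← hy]
    rw [facPow_mul_prod_Ico w y (hb j), sub_self]
  rw [h1, Matrix.det_succ_row B (Fin.last k), Fin.sum_univ_castSucc]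
  simp only [h0, mul_zero, zero_mul, sum_const_zero, zero_add, Fin.succAbove_last]
  have h2 : B.submatrix Fin.castSucc Fin.castSucc = Matrix.of fun (i j : Fin k) =>
      (x i.castSucc - y) * (Matrix.of fun (i j : Fin k) =>
        ∑ c ∈ Ico (b j.succ) (b j.castSucc), facPow w (x i.castSucc) c *
          ∏ l ∈ Ico (c + 1) (b j.castSucc), (y - w l)) i j := by
    ext i j
    simp only [B, Matrix.submatrix_apply, Matrix.of_apply, Fin.snoc_castSucc]
    exact facPow_sub_facPow_mul w _ y (hb j)
  rw [h2, Matrix.det_mul_column, det_col_sum (fun i => x (Fin.castSucc i)) w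
    (fun j => Ico (b j.succ) (b j.castSucc))
    (fun j c => ∏ l ∈ Ico (c + 1) (b j.castSucc), (y - w l))]
  simp only [B, Matrix.of_apply, Fin.snoc_last, Fin.val_last, ← two_mul, pow_mul, neg_one_sq, one_pow]
  ring

lemma alternant_betaNumber_zero_succ {k : ℕ} (x : Fin (k + 1) → R) (w : ℕ → R) :
    alternant x w (betaNumber fun _ => 0) = (∏ i : Fin k, (x i.castSucc - x (Fin.last k))) *
      alternant (fun i => x i.castSucc) w (betaNumber fun _ => 0) := by
  rw [alternant_succ x w _ (fun j => by simp [betaNumber]; omega)]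
  have : (Fintype.piFinset fun j : Fin k => Ico (betaNumber (fun _ : Fin (k + 1) => 0) j.succ)
      (betaNumber (fun _ : Fin (k + 1) => 0) j.castSucc)) = {betaNumber fun _ => 0} := by
    ext c
    simp only [Fintype.mem_piFinset, mem_Ico, mem_singleton, funext_iff, betaNumber, Fin.val_succ,
      Fin.val_castSucc]
    exact forall_congr' fun j => by have := j.isLt; omega
  rw [this, sum_singleton]
  rw [prod_eq_one fun j _ => prod_eq_one fun l hl => ?_]
  · simp [betaNumber]
  · simp only [betaNumber, Fin.val_castSucc, mem_Ico] at hl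
    omega

lemma alternant_betaNumber_zero_eq {k : ℕ} (x : Fin k → R) (w w' : ℕ → R) :
    alternant x w (betaNumber fun _ => 0) = alternant x w' (betaNumber fun _ => 0) := by
  induction k with
  | zero => simp [alternant]
  | succ k ih => rw [alternant_betaNumber_zero_succ, ih, ← alternant_betaNumber_zero_succ]

lemma alternant_betaNumber_zero_ne_zero [IsDomain R] {k : ℕ} (x : Fin k → R) (w : ℕ → R)
    (hx : Function.Injective x) : alternant x w (betaNumber fun _ => 0) ≠ 0 := by
  induction k with
  | zero => simp [alternant]
  | succ k ih =>
    rw [alternant_betaNumber_zero_succ]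
    refine mul_ne_zero (prod_ne_zero_iff.2 fun i _ => sub_ne_zero.2 fun h => ?_)
      (ih _ (hx.comp (Fin.castSucc_injective k)))
    exact (Fin.castSucc_lt_last i).ne (hx h)

lemma alternant_comp_perm {k : ℕ} (x : Fin k → R) (w : ℕ → R) (b : Fin k → ℕ)
    (τ : Equiv.Perm (Fin k)) :
    alternant x w (b ∘ τ) = (Equiv.Perm.sign τ : ℤ) • alternant x w b := by
  rw [alternant, alternant, ← Matrix.det_transpose, zsmul_eq_mul,
    ← Matrix.det_transpose (Matrix.of fun i j => facPow w (x i) (b j)), ← Matrix.det_permute]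
  rfl

lemma alternant_eq_zero {k : ℕ} (x : Fin k → R) (w : ℕ → R) {b : Fin k → ℕ} {i j : Fin k}
    (hij : i ≠ j) (h : b i = b j) : alternant x w b = 0 :=
  Matrix.det_zero_of_column_eq hij fun a => by simp [h]

lemma map_facPow {S : Type*} [CommRing S] (f : R →+* S) (w : ℕ → R) (x : R) (m : ℕ) :
    f (facPow w x m) = facPow (fun i => f (w i)) (f x) m := by
  simp [facPow]

lemma map_alternant {S : Type*} [CommRing S] (f : R →+* S) {k : ℕ} (x : Fin k → R) (w : ℕ → R)
    (b : Fin k → ℕ) :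
    f (alternant x w b) = alternant (fun i => f (x i)) (fun i => f (w i)) b := by
  rw [alternant, RingHom.map_det]
  congr 1
  ext i j
  simp [map_facPow]

end Alternant

/-! ### The bialternant formula for tableau sums -/

section Tableaux

variable {R : Type*} [CommRing R]

open Classical in
/-- The tableau sum `∑_T ∏_α (x_{T(α)} - w_{T(α)+c(α)})` over an arbitrary commutative ring. -/
noncomputable def tabSum {k : ℕ} (x : Fin k → R) (w : ℕ → R) (p : Fin k → ℕ) : R :=
  ∑ T : Filling p with IsSemistandard p T, ∏ i : Fin k, ∏ j : Fin (p i),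
    (x (T i j) - w ((T i j).val + j.val - i.val))

/-- In a weakly increasing row the entries different from the largest one form an initial segment. -/
lemma exists_cut {k m : ℕ} {f : Fin m → Fin (k + 1)} (hf : Monotone f) :
    ∃ c ≤ m, ∀ j : Fin m, f j ≠ Fin.last k ↔ j.val < c := by
  classical
  have hex : ∃ c, ∀ j : Fin m, c ≤ j.val → f j = Fin.last k := ⟨m, fun j hj => by omega⟩
  refine ⟨Nat.find hex, Nat.find_min' hex fun j hj => by omega, fun j => ⟨fun h => ?_, fun h h' => ?_⟩⟩
  · by_contra hlt
    exact h (Nat.find_spec hex j (not_lt.1 hlt))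
  · refine Nat.find_min hex h fun j' hj' => ?_
    exact le_antisymm (Fin.le_last _) (h' ▸ hf hj')

lemma IsSemistandard.le_entry {k : ℕ} {p : Fin k → ℕ} (hp : Antitone p) {T : Filling p}
    (hT : IsSemistandard p T) (i : Fin k) (j : Fin (p i)) : i.val ≤ (T i j).val := by
  obtain ⟨i, hi⟩ := i
  induction i with
  | zero => simp
  | succ i ih =>
    have hlt : (⟨i, by omega⟩ : Fin k) < ⟨i + 1, hi⟩ := by simp
    have hj : j.val < p ⟨i, by omega⟩ := j.isLt.trans_le (hp hlt.le)
    exact lt_of_le_of_lt (ih (by omega) ⟨j.val, hj⟩) (hT.2 _ _ j.val hj j.isLt hlt)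

/-- The filling of `p` that agrees with `T` on `p'` and has the largest entry elsewhere. -/
def extendFilling {k : ℕ} (p : Fin (k + 1) → ℕ) {p' : Fin k → ℕ} (T : Filling p') : Filling p :=
  fun i j => if h : ∃ hi : i.val < k, j.val < p' ⟨i.val, hi⟩ then
    (T ⟨i.val, h.1⟩ ⟨j.val, h.2⟩).castSucc else Fin.last k

/-- The restriction to `p'` of a filling of `p` whose entries in `p'` are not the largest one
(other entries get a dummy value). -/
def restrictFilling {k : ℕ} {p : Fin (k + 1) → ℕ} {p' : Fin k → ℕ}
    (hp' : ∀ i : Fin k, p' i ≤ p i.castSucc) (T : Filling p) : Filling p' :=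
  fun i j => if h : T i.castSucc ⟨j.val, j.isLt.trans_le (hp' i)⟩ = Fin.last k then i else
    (T i.castSucc ⟨j.val, j.isLt.trans_le (hp' i)⟩).castPred h

lemma extendFilling_castSucc_of_lt {k : ℕ} {p : Fin (k + 1) → ℕ} {p' : Fin k → ℕ} (T : Filling p')
    (i : Fin k) (j : Fin (p i.castSucc)) (h : j.val < p' i) :
    extendFilling p T i.castSucc j = (T i ⟨j.val, h⟩).castSucc :=
  dif_pos ⟨i.isLt, h⟩

lemma extendFilling_castSucc_of_le {k : ℕ} {p : Fin (k + 1) → ℕ} {p' : Fin k → ℕ} (T : Filling p')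
    (i : Fin k) (j : Fin (p i.castSucc)) (h : p' i ≤ j.val) :
    extendFilling p T i.castSucc j = Fin.last k :=
  dif_neg fun ⟨_, h'⟩ => absurd h' (not_lt.2 h)

lemma extendFilling_last {k : ℕ} {p : Fin (k + 1) → ℕ} {p' : Fin k → ℕ} (T : Filling p')
    (j : Fin (p (Fin.last k))) : extendFilling p T (Fin.last k) j = Fin.last k :=
  dif_neg fun ⟨h', _⟩ => absurd h' (by simp)

lemma antitone_of_interlacing {k : ℕ} {p : Fin (k + 1) → ℕ} {p' : Fin k → ℕ} (hp : Antitone p)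
    (h : ∀ i : Fin k, p i.succ ≤ p' i ∧ p' i ≤ p i.castSucc) : Antitone p' := by
  intro i j hij
  rcases hij.eq_or_lt with rfl | hlt
  · exact le_rfl
  · exact (h j).2.trans ((hp (by rw [Fin.le_def]; simpa using hlt)).trans (h i).1)

lemma isSemistandard_extendFilling {k : ℕ} {p : Fin (k + 1) → ℕ} {p' : Fin k → ℕ} (hp : Antitone p)
    (h : ∀ i : Fin k, p i.succ ≤ p' i ∧ p' i ≤ p i.castSucc) {T : Filling p'}
    (hT : IsSemistandard p' T) : IsSemistandard p (extendFilling p T) := by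
  constructor
  · intro i j j' hjj
    induction i using Fin.lastCases with
    | last => rw [extendFilling_last, extendFilling_last]
    | cast i =>
      by_cases hj' : j'.val < p' i
      · rw [extendFilling_castSucc_of_lt T i j' hj',
          extendFilling_castSucc_of_lt T i j (lt_of_le_of_lt hjj hj')]
        exact Fin.castSucc_le_castSucc_iff.2 (hT.1 i hjj)
      · rw [extendFilling_castSucc_of_le T i j' (not_lt.1 hj')]
        exact Fin.le_last _
  · intro i i' j hj hj' hii
    induction i using Fin.lastCases with
    | last => exact absurd (Fin.le_last i') (not_le.2 hii)
    | cast i =>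
      have hji : j < p' i := hj'.trans_le
        ((hp (show i.succ ≤ i' from Nat.succ_le_of_lt hii)).trans (h i).1)
      rw [extendFilling_castSucc_of_lt T i ⟨j, hj⟩ hji]
      induction i' using Fin.lastCases with
      | last => rw [extendFilling_last]; exact Fin.castSucc_lt_last _
      | cast i' =>
        by_cases h2 : j < p' i'
        · rw [extendFilling_castSucc_of_lt T i' ⟨j, hj'⟩ h2]
          exact Fin.castSucc_lt_castSucc_iff.2 (hT.2 i i' j hji h2 (by simpa using hii))
        · rw [extendFilling_castSucc_of_le T i' ⟨j, hj'⟩ (not_lt.1 h2)]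
          exact Fin.castSucc_lt_last _

lemma castSucc_restrictFilling {k : ℕ} {p : Fin (k + 1) → ℕ} {p' : Fin k → ℕ}
    (hp' : ∀ i : Fin k, p' i ≤ p i.castSucc) {T : Filling p}
    (hT : ∀ (i : Fin k) (j : Fin (p i.castSucc)), T i.castSucc j ≠ Fin.last k ↔ j.val < p' i)
    (i : Fin k) (j : Fin (p' i)) :
    (restrictFilling hp' T i j).castSucc = T i.castSucc ⟨j.val, j.isLt.trans_le (hp' i)⟩ := by
  rw [restrictFilling, dif_neg ((hT i _).2 j.isLt), Fin.castSucc_castPred]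

lemma prod_extendFilling {k : ℕ} {p : Fin (k + 1) → ℕ} {p' : Fin k → ℕ}
    (hp' : ∀ i : Fin k, p' i ≤ p i.castSucc) (T : Filling p') (i : Fin k) (g : Fin (k + 1) → ℕ → R) :
    ∏ j : Fin (p i.castSucc), g (extendFilling p T i.castSucc j) j.val =
      (∏ j : Fin (p' i), g (T i j).castSucc j.val) *
        ∏ j ∈ Ico (p' i) (p i.castSucc), g (Fin.last k) j := by
  let G : ℕ → R := fun j => if h : j < p' i then g (T i ⟨j, h⟩).castSucc j else g (Fin.last k) j
  have h1 : ∏ j : Fin (p i.castSucc), g (extendFilling p T i.castSucc j) j.val =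
      ∏ j ∈ range (p i.castSucc), G j := by
    rw [prod_range]
    refine prod_congr rfl fun j _ => ?_
    by_cases h : j.val < p' i
    · simp [G, h, extendFilling_castSucc_of_lt T i j h]
    · simp [G, h, extendFilling_castSucc_of_le T i j (not_lt.1 h)]
  have h2 : ∏ j : Fin (p' i), g (T i j).castSucc j.val = ∏ j ∈ range (p' i), G j := by
    rw [prod_range]
    exact prod_congr rfl fun j _ => by simp [G]
  have h3 : ∏ j ∈ Ico (p' i) (p i.castSucc), g (Fin.last k) j =
      ∏ j ∈ Ico (p' i) (p i.castSucc), G j :=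
    prod_congr rfl fun j hj => by simp [G, not_lt.2 (mem_Ico.1 hj).1]
  rw [h1, h2, h3, prod_range_mul_prod_Ico _ (hp' i)]

/-- The branching rule: the boxes with the largest entry form a horizontal strip. -/
lemma tabSum_succ {k : ℕ} (x : Fin (k + 1) → R) (w : ℕ → R) (p : Fin (k + 1) → ℕ)
    (hp : Antitone p) :
    tabSum x w p = (∏ j ∈ range (p (Fin.last k)), (x (Fin.last k) - w j)) *
      ∑ p' ∈ Fintype.piFinset fun i : Fin k => Icc (p i.succ) (p i.castSucc),
        (∏ i : Fin k, ∏ j ∈ Ico (p' i) (p i.castSucc), (x (Fin.last k) - w (k + j - i.val))) *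
          tabSum (fun i => x i.castSucc) w p' := by
  classical
  have hcut : ∀ T : Filling p, ∃ p' : Fin k → ℕ, IsSemistandard p T →
      ∀ i : Fin k, p' i ≤ p i.castSucc ∧
        ∀ j : Fin (p i.castSucc), T i.castSucc j ≠ Fin.last k ↔ j.val < p' i := by
    intro T
    by_cases hT : IsSemistandard p T
    · choose c hc using fun i : Fin k => exists_cut (hT.1 i.castSucc)
      exact ⟨c, fun _ => hc⟩
    · exact ⟨0, fun h => absurd h hT⟩
  choose cut hcut using hcut
  have hmaps : ∀ T ∈ ({T : Filling p | IsSemistandard p T} : Finset (Filling p)),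
      cut T ∈ Fintype.piFinset fun i : Fin k => Icc (p i.succ) (p i.castSucc) := by
    intro T hT
    have hT' : IsSemistandard p T := (mem_filter.1 hT).2
    rw [Fintype.mem_piFinset]
    refine fun i => mem_Icc.2 ⟨?_, (hcut T hT' i).1⟩
    by_contra hlt
    rw [not_le] at hlt
    have h1 : cut T i < p i.castSucc := hlt.trans_le (hp i.castSucc_lt_succ.le)
    have h2 := hT'.2 i.castSucc i.succ (cut T i) h1 hlt i.castSucc_lt_succ
    exact absurd (((hcut T hT' i).2 ⟨cut T i, h1⟩).1 (h2.trans_le (Fin.le_last _)).ne) (lt_irrefl _)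
  rw [tabSum, ← sum_fiberwise_of_maps_to hmaps, mul_sum]
  refine sum_congr rfl fun p' hp' => ?_
  rw [Fintype.mem_piFinset] at hp'
  simp only [mem_Icc] at hp'
  rw [tabSum, mul_sum, mul_sum]
  symm
  refine sum_nbij' (extendFilling p) (restrictFilling fun i => (hp' i).2) ?_ ?_ ?_ ?_ ?_
  · intro T hT
    have hT' := isSemistandard_extendFilling hp hp' (mem_filter.1 hT).2
    refine mem_filter.2 ⟨mem_filter.2 ⟨mem_univ _, hT'⟩, funext fun i => ?_⟩
    obtain ⟨hle, hiff⟩ := hcut _ hT' i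
    refine le_antisymm (not_lt.1 fun hlt => ?_) (not_lt.1 fun hlt => ?_)
    · have := (hiff ⟨p' i, hlt.trans_le hle⟩).2 hlt
      exact this (extendFilling_castSucc_of_le T i _ le_rfl)
    · have := mt (hiff ⟨_, hlt.trans_le (hp' i).2⟩).1 (lt_irrefl _)
      rw [not_not, extendFilling_castSucc_of_lt T i _ hlt] at this
      exact (Fin.castSucc_lt_last _).ne this
  · intro T hT
    obtain ⟨hmem, rfl⟩ := mem_filter.1 hT
    have hT : IsSemistandard p T := (mem_filter.1 hmem).2
    have hr := castSucc_restrictFilling (fun i => (hp' i).2) (fun i => (hcut T hT i).2)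
    refine mem_filter.2 ⟨mem_univ _, fun i j j' hj => ?_, fun i i' j h h' hi => ?_⟩
    · rw [← Fin.castSucc_le_castSucc_iff, hr, hr]
      exact hT.1 _ hj
    · rw [← Fin.castSucc_lt_castSucc_iff, hr, hr]
      exact hT.2 _ _ _ _ _ (by simpa using hi)
  · intro T _
    funext i j
    have h := extendFilling_castSucc_of_lt T i ⟨j.val, j.isLt.trans_le (hp' i).2⟩ j.isLt
    rw [restrictFilling, dif_neg (by rw [h]; exact (Fin.castSucc_lt_last _).ne)]
    exact Fin.castSucc_injective _ (by rw [Fin.castSucc_castPred, h])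
  · intro T hT
    obtain ⟨hmem, rfl⟩ := mem_filter.1 hT
    have hT : IsSemistandard p T := (mem_filter.1 hmem).2
    have hr := castSucc_restrictFilling (fun i => (hp' i).2) (fun i => (hcut T hT i).2)
    funext i j
    induction i using Fin.lastCases with
    | last =>
      rw [extendFilling_last]
      exact (le_antisymm (Fin.le_last _) (by rw [Fin.le_def]; exact hT.le_entry hp _ j)).symm
    | cast i =>
      by_cases hj : j.val < cut T i
      · rw [extendFilling_castSucc_of_lt _ i j hj, hr]
      · rw [extendFilling_castSucc_of_le _ i j (not_lt.1 hj)]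
        exact (not_not.1 (mt ((hcut T hT i).2 j).1 hj)).symm
  · intro T _
    rw [Fin.prod_univ_castSucc]
    have h : ∀ i : Fin k, ∏ j : Fin (p i.castSucc),
        (x (extendFilling p T i.castSucc j) -
          w ((extendFilling p T i.castSucc j).val + j.val - i.castSucc.val)) =
        (∏ j : Fin (p' i), (x (T i j).castSucc - w ((T i j).val + j.val - i.val))) *
          ∏ j ∈ Ico (p' i) (p i.castSucc), (x (Fin.last k) - w (k + j - i.val)) := fun i => by
      simpa using prod_extendFilling (fun i => (hp' i).2) T i
        fun a j => x a - w (a.val + j - i.val)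
    rw [prod_congr rfl fun i _ => h i, prod_mul_distrib, prod_range]
    simp only [extendFilling_last, Fin.val_last, Nat.add_sub_cancel_left]
    ring

/-- The bialternant formula for factorial Schur polynomials. -/
theorem tabSum_mul_alternant {k : ℕ} (x : Fin k → R) (w : ℕ → R) (p : Fin k → ℕ)
    (hp : Antitone p) :
    tabSum x w p * alternant x w (betaNumber fun _ => 0) = alternant x w (betaNumber p) := by
  induction k with
  | zero =>
    classical
    rw [tabSum, filter_true_of_mem fun T _ => ⟨fun i => i.elim0, fun i => i.elim0⟩]
    simp [alternant]
  | succ k ih =>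
    have hb : ∀ j : Fin k, betaNumber p j.succ ≤ betaNumber p j.castSucc := fun j => by
      have := hp j.castSucc_lt_succ.le
      simp only [betaNumber, Fin.val_succ, Fin.val_castSucc]
      omega
    rw [tabSum_succ x w p hp, alternant_betaNumber_zero_succ, alternant_succ x w _ hb]
    have hlast : betaNumber p (Fin.last k) = p (Fin.last k) := by simp [betaNumber]
    rw [hlast, facPow]
    have hsum : (∑ p' ∈ Fintype.piFinset fun i : Fin k => Icc (p i.succ) (p i.castSucc),
        (∏ i : Fin k, ∏ j ∈ Ico (p' i) (p i.castSucc), (x (Fin.last k) - w (k + j - i.val))) *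
          tabSum (fun i => x i.castSucc) w p') *
          alternant (fun i => x i.castSucc) w (betaNumber fun _ => 0) =
        ∑ c ∈ Fintype.piFinset fun j : Fin k =>
          Ico (betaNumber p j.succ) (betaNumber p j.castSucc),
          (∏ j : Fin k, ∏ l ∈ Ico (c j + 1) (betaNumber p j.castSucc),
            (x (Fin.last k) - w l)) * alternant (fun i => x i.castSucc) w c := by
      rw [sum_mul]
      refine sum_nbij' betaNumber (fun c i => c i - (k - 1 - i.val)) ?_ ?_ ?_ ?_ ?_
      · intro p' hp'
        simp only [Fintype.mem_piFinset, mem_Icc, mem_Ico, betaNumber, Fin.val_succ,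
          Fin.val_castSucc] at hp' ⊢
        intro i
        have := hp' i
        omega
      · intro c hc
        simp only [Fintype.mem_piFinset, mem_Icc, mem_Ico, betaNumber, Fin.val_succ,
          Fin.val_castSucc] at hc ⊢
        intro i
        have := hc i
        omega
      · intro p' _
        funext i
        simp [betaNumber]
      · intro c hc
        simp only [Fintype.mem_piFinset, mem_Ico, betaNumber, Fin.val_succ,
          Fin.val_castSucc] at hc
        funext i
        have := hc i
        simp only [betaNumber]
        omega
      · intro p' hp'
        simp only [Fintype.mem_piFinset, mem_Icc] at hp'
        rw [mul_assoc, ih _ _ (antitone_of_interlacing hp hp')]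
        congr 1
        refine prod_congr rfl fun i _ => ?_
        have e1 : betaNumber p' i + 1 = p' i + (k - i.val) := by
          simp only [betaNumber]
          omega
        have e2 : betaNumber p i.castSucc = p i.castSucc + (k - i.val) := by simp [betaNumber]
        rw [e1, e2, ← prod_Ico_add']
        refine prod_congr rfl fun j _ => ?_
        congr 2
        omega
    rw [← hsum]
    ring

lemma map_tabSum {S : Type*} [CommRing S] (f : R →+* S) {k : ℕ} (x : Fin k → R) (w : ℕ → R)
    (p : Fin k → ℕ) :
    f (tabSum x w p) = tabSum (fun i => f (x i)) (fun i => f (w i)) p := by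
  simp [tabSum]

lemma tabSum_congr {k N : ℕ} (x : Fin k → R) {w w' : ℕ → R} (hw : ∀ i < N, w i = w' i)
    (p : BoxPartition k N) : tabSum x w p.1 = tabSum x w' p.1 := by
  refine sum_congr rfl fun T _ => prod_congr rfl fun i _ => prod_congr rfl fun j _ => ?_
  rw [hw]
  have h1 := (T i j).isLt
  have h2 := j.isLt
  have h3 := p.2.2 i
  omega

end Tableaux

/-! ### Beta numbers -/

section Beta

lemma betaNumber_strictAnti {k : ℕ} {p : Fin k → ℕ} (hp : Antitone p) :
    StrictAnti (betaNumber p) := by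
  intro i j hij
  have h1 := hp hij.le
  have h2 : i.val < j.val := hij
  have h3 := j.isLt
  simp only [betaNumber]
  omega

lemma betaNumber_lt {k N : ℕ} (hkN : k ≤ N) (p : BoxPartition k N) (i : Fin k) :
    betaNumber p.1 i < N := by
  have h1 := p.2.2 i
  have h2 := i.isLt
  simp only [betaNumber]
  omega

lemma betaNumber_injective {k : ℕ} : Function.Injective (betaNumber (k := k)) := by
  intro p p' h
  funext i
  have := congrFun h i
  simp only [betaNumber] at this
  omega

lemma antitone_add_val_of_strictAnti {k : ℕ} {b : Fin k → ℕ} (hb : StrictAnti b) :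
    Antitone fun i => b i + i.val := by
  intro i j hij
  obtain ⟨j, hj⟩ := j
  induction j with
  | zero =>
    obtain rfl : i = ⟨0, hj⟩ := Fin.ext (Nat.le_zero.1 hij)
    exact le_rfl
  | succ j ih =>
    rcases hij.eq_or_lt with rfl | hlt
    · exact le_rfl
    · have h1 := ih (by omega) (Nat.le_of_lt_succ hlt)
      have h2 : b ⟨j + 1, hj⟩ < b ⟨j, by omega⟩ := hb (by simp)
      dsimp only at h1 ⊢
      omega

/-- Every strictly decreasing sequence of naturals below `N` is the beta sequence of a partition in
the `k × (N - k)` box. -/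
lemma exists_betaNumber_eq {k N : ℕ} {b : Fin k → ℕ} (hb : StrictAnti b) (hN : ∀ i, b i < N) :
    ∃ g : BoxPartition k N, betaNumber g.1 = b := by
  have hanti := antitone_add_val_of_strictAnti hb
  have hlow : ∀ i : Fin k, k - 1 - i.val ≤ b i := fun i => by
    have hi := i.isLt
    have h : b ⟨k - 1, by omega⟩ + (k - 1) ≤ b i + i.val :=
      hanti (Fin.le_def.2 (Nat.le_sub_one_of_lt hi))
    omega
  refine ⟨⟨fun i => b i - (k - 1 - i.val), fun i j hij => ?_, fun i => ?_⟩, funext fun i => ?_⟩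
  · have h1 : b j + j.val ≤ b i + i.val := hanti hij
    have h2 := hlow i
    have h3 := hlow j
    dsimp only
    omega
  · have h1 : b i + i.val ≤ b ⟨0, i.pos⟩ + 0 := hanti (Fin.le_def.2 (Nat.zero_le _))
    have h2 := hN ⟨0, i.pos⟩
    have h3 := hlow i
    have h4 := i.isLt
    dsimp only
    omega
  · have := hlow i
    simp only [betaNumber]
    omega

end Beta

/-! ### Linear independence of alternants modulo a monic polynomial in each variable -/

section Independence

open Polynomial

variable {R : Type*} [CommRing R]

lemma facPow_X_monic_natDegree [Nontrivial R] (w : ℕ → R) (m : ℕ) :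
    (facPow (fun i => C (w i)) (X : R[X]) m).Monic ∧
      (facPow (fun i => C (w i)) (X : R[X]) m).natDegree = m := by
  refine ⟨monic_prod_of_monic _ _ fun i _ => monic_X_sub_C _, ?_⟩
  rw [facPow, natDegree_prod_of_monic _ _ fun i _ => monic_X_sub_C _]
  simp

lemma aeval_facPow {k : ℕ} (w : ℕ → R) (i : Fin k) (m : ℕ) :
    aeval (MvPolynomial.X i : MvPolynomial (Fin k) R) (facPow (fun i => C (w i)) X m) =
      facPow (fun i => MvPolynomial.C (w i)) (MvPolynomial.X i) m := by
  simp [facPow, MvPolynomial.algebraMap_eq]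

/-- The tensor product of linear functionals on `R[X]`, as a functional on
`R[X₁, …, X_k] = R[X]^{⊗ k}`. -/
noncomputable def tensorFunctional {k : ℕ} (L : Fin k → R[X] →ₗ[R] R) :
    MvPolynomial (Fin k) R →ₗ[R] R :=
  (MvPolynomial.basisMonomials (Fin k) R).constr R fun m => ∏ i, L i (X ^ m i)

lemma tensorFunctional_monomial {k : ℕ} (L : Fin k → R[X] →ₗ[R] R) (m : Fin k → ℕ) :
    tensorFunctional L (∏ i, MvPolynomial.X i ^ m i) = ∏ i, L i (X ^ m i) := by
  have h := (MvPolynomial.basisMonomials (Fin k) R).constr_basis R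
    (fun m => ∏ i, L i (X ^ m i)) (Finsupp.equivFunOnFinite.symm m)
  rw [MvPolynomial.coe_basisMonomials] at h
  beta_reduce at h
  rw [MvPolynomial.monomial_eq,
    Finsupp.prod_fintype _ _ fun i => by simp] at h
  simpa [tensorFunctional] using h

lemma tensorFunctional_prod {k : ℕ} (L : Fin k → R[X] →ₗ[R] R) (f : Fin k → R[X]) :
    tensorFunctional L (∏ i, aeval (MvPolynomial.X i) (f i)) = ∏ i, L i (f i) := by
  have h : (tensorFunctional L).compMultilinearMap
      ((MultilinearMap.mkPiAlgebra R (Fin k) (MvPolynomial (Fin k) R)).compLinearMap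
        fun i => (aeval (MvPolynomial.X i : MvPolynomial (Fin k) R)).toLinearMap) =
      (MultilinearMap.mkPiAlgebra R (Fin k) R).compLinearMap L := by
    refine Module.Basis.ext_multilinear (fun _ => Polynomial.basisMonomials R) fun v => ?_
    simp [Polynomial.coe_basisMonomials, ← X_pow_eq_monomial, tensorFunctional_monomial]
  simpa using congrArg (fun F => F f) h

lemma tensorFunctional_eq_zero {k : ℕ} (L : Fin k → R[X] →ₗ[R] R) {Q : R[X]}
    (hL : ∀ i f, L i (f * Q) = 0) {F : MvPolynomial (Fin k) R}
    (hF : F ∈ Ideal.span (Set.range fun i : Fin k => aeval (MvPolynomial.X i) Q)) :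
    tensorFunctional L F = 0 := by
  obtain ⟨c, rfl⟩ := Ideal.mem_span_range_iff_exists_fun.1 hF
  rw [map_sum]
  refine sum_eq_zero fun i _ => ?_
  have h : (tensorFunctional L) ∘ₗ
      LinearMap.mulRight R (aeval (MvPolynomial.X i : MvPolynomial (Fin k) R) Q) = 0 := by
    refine (MvPolynomial.basisMonomials (Fin k) R).ext fun m => ?_
    have e : (MvPolynomial.basisMonomials (Fin k) R) m * aeval (MvPolynomial.X i) Q =
        ∏ j, aeval (MvPolynomial.X j : MvPolynomial (Fin k) R)
          (X ^ m j * if j = i then Q else 1) := by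
      rw [MvPolynomial.coe_basisMonomials]
      beta_reduce
      rw [MvPolynomial.monomial_eq,
        Finsupp.prod_fintype _ _ fun i => by simp]
      simp only [map_mul, prod_mul_distrib, apply_ite (aeval _), map_one, prod_ite_eq', mem_univ,
        if_true, map_pow, aeval_X, one_mul]
    rw [LinearMap.comp_apply, LinearMap.mulRight_apply, e, tensorFunctional_prod]
    exact prod_eq_zero (mem_univ i) (by simp [hL])
  exact congrArg (fun G => G (c i)) h

variable [IsDomain R]

/-- The factorial powers of the variable form a basis of `R[X]`. -/
noncomputable def facPowBasis (w : ℕ → R) : Module.Basis ℕ R R[X] :=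
  Polynomial.Sequence.basis
    { elems' := facPow (fun i => C (w i)) X
      degree_eq' := fun i => by
        rw [degree_eq_natDegree (facPow_X_monic_natDegree w i).1.ne_zero,
          (facPow_X_monic_natDegree w i).2] }
    fun i => by
      exact (facPow_X_monic_natDegree w i).1.symm ▸ isUnit_one

lemma facPowBasis_apply (w : ℕ → R) (m : ℕ) :
    facPowBasis w m = facPow (fun i => C (w i)) X m :=
  Polynomial.Sequence.basis_eq_self _ _ _

/-- The coefficient of the factorial power `(X|w)^m` in the remainder of a polynomial modulo `Q`. -/
noncomputable def remCoeff (w : ℕ → R) (Q : R[X]) (m : ℕ) : R[X] →ₗ[R] R :=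
  (facPowBasis w).coord m ∘ₗ Q.modByMonicHom

lemma remCoeff_mul_self (w : ℕ → R) {Q : R[X]} (hQ : Q.Monic) (m : ℕ) (f : R[X]) :
    remCoeff w Q m (f * Q) = 0 := by
  simp [remCoeff, (modByMonic_eq_zero_iff_dvd hQ).2 (dvd_mul_left Q f)]

lemma remCoeff_facPow (w : ℕ → R) {Q : R[X]} (hQ : Q.Monic) {c : ℕ} (hc : c < Q.natDegree)
    (m : ℕ) : remCoeff w Q m (facPow (fun i => C (w i)) X c) = if c = m then 1 else 0 := by
  have h : facPow (fun i => C (w i)) (X : R[X]) c %ₘ Q = facPow (fun i => C (w i)) X c := by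
    rw [modByMonic_eq_self_iff hQ]
    apply degree_lt_degree
    rwa [(facPow_X_monic_natDegree w c).2]
  rw [remCoeff, LinearMap.comp_apply, modByMonicHom_apply, h, ← facPowBasis_apply,
    Module.Basis.coord_apply, Module.Basis.repr_self, Finsupp.single_apply]

lemma tensorFunctional_alternant {k : ℕ} (w : ℕ → R) {Q : R[X]} (hQ : Q.Monic)
    {b b' : Fin k → ℕ} (hb : StrictAnti b) (hb' : StrictAnti b') (hlt : ∀ i, b i < Q.natDegree) :
    tensorFunctional (fun i => remCoeff w Q (b' i))
      (alternant MvPolynomial.X (fun i => MvPolynomial.C (w i)) b) = if b = b' then 1 else 0 := by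
  rw [alternant, ← Matrix.det_transpose, Matrix.det_apply, map_sum]
  have h : ∀ σ : Equiv.Perm (Fin k), tensorFunctional (fun i => remCoeff w Q (b' i))
      (Equiv.Perm.sign σ • ∏ i, (Matrix.of fun (i j : Fin k) => facPow
        (fun i => (MvPolynomial.C (w i) : MvPolynomial (Fin k) R)) (MvPolynomial.X i)
          (b j)).transpose (σ i) i) =
      if σ = 1 ∧ b = b' then 1 else 0 := by
    intro σ
    simp only [Matrix.transpose_apply, Matrix.of_apply, ← aeval_facPow]
    rw [Units.smul_def, map_zsmul, tensorFunctional_prod]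
    simp only [remCoeff_facPow w hQ (hlt _)]
    by_cases hσ : ∀ i, b (σ i) = b' i
    · have hbb : b = b' := by
        refine (hb.range_inj hb').1 ?_
        rw [← σ.surjective.range_comp b]
        exact congrArg Set.range (funext hσ)
      have h1 : σ = 1 := Equiv.ext fun i => hb.injective ((hσ i).trans (congrFun hbb i).symm)
      subst h1 hbb
      simp
    · rw [if_neg fun h => hσ fun i => by rw [h.1, h.2]; rfl]
      obtain ⟨i, hi⟩ := not_forall.1 hσ
      rw [prod_eq_zero (mem_univ i) (if_neg hi), smul_zero]
  rw [sum_congr rfl fun σ _ => h σ, sum_eq_single 1 (by simp +contextual) (by simp)]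
  simp

/-- Alternants of partitions in the `k × (N - k)` box are linearly independent modulo the ideal
generated by the values at the variables of a monic polynomial of degree `N`. -/
theorem eq_zero_of_sum_alternant_mem {k N : ℕ} (hkN : k ≤ N) (w : ℕ → R) {Q : R[X]}
    (hQ : Q.Monic) (hdeg : Q.natDegree = N) (v : BoxPartition k N → R)
    (hv : ∑ g, MvPolynomial.C (v g) *
      alternant MvPolynomial.X (fun i => MvPolynomial.C (w i)) (betaNumber g.1) ∈
        Ideal.span (Set.range fun i : Fin k => aeval (MvPolynomial.X i) Q)) : v = 0 := by
  funext g₀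
  have h := tensorFunctional_eq_zero (fun i => remCoeff w Q (betaNumber g₀.1 i))
    (fun i f => remCoeff_mul_self w hQ _ f) hv
  simp only [← MvPolynomial.smul_eq_C_mul, map_sum, map_smul] at h
  rw [sum_eq_single g₀] at h
  · rwa [tensorFunctional_alternant w hQ (betaNumber_strictAnti g₀.2.1)
      (betaNumber_strictAnti g₀.2.1) (fun i => hdeg ▸ betaNumber_lt hkN g₀ i), if_pos rfl,
      smul_eq_mul, mul_one] at h
  · intro g _ hg
    rw [tensorFunctional_alternant w hQ (betaNumber_strictAnti g.2.1)
      (betaNumber_strictAnti g₀.2.1) (fun i => hdeg ▸ betaNumber_lt hkN g i),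
      if_neg fun h => hg (Subtype.ext (betaNumber_injective h)), smul_zero]
  · simp

end Independence

/-! ### Expansion of symmetric polynomials in factorial Schur polynomials -/

section Expansion

open MvPolynomial

variable {R : Type*} [CommRing R]

lemma exists_pow_eq_sum_facPow (w : ℕ → R) {A : Type*} [CommRing A] (φ : R →+* A) (m : ℕ) :
    ∃ u : ℕ → R, ∀ x : A,
      x ^ m = ∑ c ∈ range (m + 1), φ (u c) * facPow (fun i => φ (w i)) x c := by
  induction m with
  | zero => exact ⟨fun _ => 1, fun x => by simp⟩
  | succ m ih =>
    obtain ⟨u, hu⟩ := ih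
    refine ⟨fun c => (if c = 0 then 0 else u (c - 1)) + if c ≤ m then u c * w c else 0, fun x => ?_⟩
    have h1 : ∑ c ∈ range (m + 1 + 1),
        φ (if c ≤ m then u c * w c else 0) * facPow (fun i => φ (w i)) x c =
        ∑ c ∈ range (m + 1), φ (u c * w c) * facPow (fun i => φ (w i)) x c := by
      rw [sum_range_succ, if_neg (by omega), map_zero, zero_mul, add_zero]
      exact sum_congr rfl fun c hc => by rw [if_pos (Nat.lt_succ_iff.1 (mem_range.1 hc))]
    have h2 : ∑ c ∈ range (m + 1 + 1),
        φ (if c = 0 then 0 else u (c - 1)) * facPow (fun i => φ (w i)) x c =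
        ∑ c ∈ range (m + 1), φ (u c) * facPow (fun i => φ (w i)) x (c + 1) := by
      rw [sum_range_succ']
      simp
    simp only [map_add, add_mul, sum_add_distrib]
    rw [h1, h2, ← sum_add_distrib, pow_succ, hu, sum_mul]
    exact sum_congr rfl fun c _ => by rw [facPow_succ, map_mul]; ring

/-- Polynomials of bounded degree in each variable are combinations of products of factorial
powers of the variables. -/
lemma mem_span_prod_facPow {k : ℕ} (w : ℕ → R) {N : ℕ} {F : MvPolynomial (Fin k) R}
    (hF : ∀ i, degreeOf i F < N) :
    F ∈ Submodule.span R {G | ∃ c : Fin k → ℕ, (∀ i, c i < N) ∧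
      G = ∏ i, facPow (fun i => C (w i)) (X i) (c i)} := by
  rw [F.as_sum]
  refine Submodule.sum_mem _ fun m hm => ?_
  have hmN : ∀ i, m i < N := fun i => (degreeOf_le_iff.1 le_rfl m hm).trans_lt (hF i)
  rw [monomial_eq, ← smul_eq_C_mul, Finsupp.prod_fintype _ _ fun i => by simp]
  refine Submodule.smul_mem _ _ ?_
  choose u hu using fun i : Fin k =>
    exists_pow_eq_sum_facPow w (C : R →+* MvPolynomial (Fin k) R) (m i)
  rw [prod_congr rfl fun i _ => hu i (X i), prod_univ_sum]
  refine Submodule.sum_mem _ fun c hc => ?_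
  rw [prod_mul_distrib, ← map_prod, ← smul_eq_C_mul]
  refine Submodule.smul_mem _ _ (Submodule.subset_span ⟨c, fun i => ?_, rfl⟩)
  have h1 := mem_range.1 (Fintype.mem_piFinset.1 hc i)
  have h2 := hmN i
  omega

/-- Antisymmetrization over all permutations of the variables. -/
noncomputable def antisymmetrize (k : ℕ) : MvPolynomial (Fin k) R →ₗ[R] MvPolynomial (Fin k) R :=
  ∑ σ : Equiv.Perm (Fin k), (Equiv.Perm.sign σ : ℤ) • (rename σ).toLinearMap

lemma antisymmetrize_apply {k : ℕ} (F : MvPolynomial (Fin k) R) :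
    antisymmetrize k F = ∑ σ : Equiv.Perm (Fin k), (Equiv.Perm.sign σ : ℤ) • rename σ F := by
  simp [antisymmetrize]

lemma rename_facPow {k : ℕ} (w : ℕ → R) (σ : Equiv.Perm (Fin k)) (i : Fin k) (m : ℕ) :
    rename σ (facPow (fun i => C (w i)) (X i) m : MvPolynomial (Fin k) R) =
      facPow (fun i => C (w i)) (X (σ i)) m := by
  simp [facPow]

lemma antisymmetrize_prod_facPow {k : ℕ} (w : ℕ → R) (c : Fin k → ℕ) :
    antisymmetrize k (∏ i, facPow (fun i => C (w i)) (X i) (c i) : MvPolynomial (Fin k) R) =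
      alternant X (fun i => C (w i)) c := by
  rw [antisymmetrize_apply, alternant, Matrix.det_apply']
  refine sum_congr rfl fun σ _ => ?_
  rw [map_prod, zsmul_eq_mul]
  simp [rename_facPow]

lemma antisymmetrize_mul {k : ℕ} {f : MvPolynomial (Fin k) R} (hf : f.IsSymmetric)
    (F : MvPolynomial (Fin k) R) : antisymmetrize k (f * F) = f * antisymmetrize k F := by
  rw [antisymmetrize_apply, antisymmetrize_apply, mul_sum]
  exact sum_congr rfl fun σ _ => by rw [map_mul, hf σ, mul_smul_comm]

lemma alternant_mem_span {k N : ℕ} {x : Fin k → MvPolynomial (Fin k) R}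
    {w : ℕ → MvPolynomial (Fin k) R} {c : Fin k → ℕ} (hc : ∀ i, c i < N) :
    alternant x w c ∈ Submodule.span R
      (Set.range fun g : BoxPartition k N => alternant x w (betaNumber g.1)) := by
  by_cases hinj : Function.Injective c
  · let τ : Equiv.Perm (Fin k) := Fin.revPerm.trans (Tuple.sort c)
    have hanti : StrictAnti (c ∘ τ) := by
      have h1 : StrictMono (c ∘ Tuple.sort c) :=
        (Tuple.monotone_sort c).strictMono_of_injective (hinj.comp (Tuple.sort c).injective)
      intro i j hij
      exact h1 (Fin.rev_lt_rev.2 hij)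
    obtain ⟨g, hg⟩ := exists_betaNumber_eq hanti fun i => hc (τ i)
    have h' : alternant x w c = (Equiv.Perm.sign τ : ℤ) • alternant x w (c ∘ τ) := by
      rw [alternant_comp_perm, smul_smul, ← Units.val_mul, ← pow_two, Int.units_sq]
      simp
    rw [h', ← hg]
    exact Submodule.smul_of_tower_mem _ _ (Submodule.subset_span ⟨g, rfl⟩)
  · obtain ⟨i, j, hij, hne⟩ : ∃ i j, c i = c j ∧ i ≠ j := by
      simpa [Function.Injective] using hinj
    rw [alternant_eq_zero x w hne hij]
    exact Submodule.zero_mem _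

lemma rename_alternant {k : ℕ} (w : ℕ → R) (σ : Equiv.Perm (Fin k)) (b : Fin k → ℕ) :
    rename σ (alternant X (fun i => C (w i)) b : MvPolynomial (Fin k) R) =
      (Equiv.Perm.sign σ : ℤ) • alternant X (fun i => C (w i)) b := by
  have h := map_alternant (rename σ : MvPolynomial (Fin k) R →ₐ[R] _).toRingHom X
    (fun i => C (w i)) b
  simp only [AlgHom.toRingHom_eq_coe, RingHom.coe_coe, rename_X, rename_C] at h
  rw [h, zsmul_eq_mul, alternant, alternant, ← Matrix.det_permute]
  rfl

lemma degreeOf_X_sub_C_le {k : ℕ} (v a : Fin k) (r : R) :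
    degreeOf v (X a - C r : MvPolynomial (Fin k) R) ≤ if a = v then 1 else 0 := by
  rcases subsingleton_or_nontrivial R with h | h
  · rw [Subsingleton.elim (X a - C r : MvPolynomial (Fin k) R) 0, degreeOf_zero]
    exact Nat.zero_le _
  refine (degreeOf_sub_le _ _ _).trans ?_
  rw [degreeOf_X, degreeOf_C, Nat.max_zero]
  simp [eq_comm]

lemma degreeOf_prod_facPow_le {k : ℕ} (w : ℕ → R) (c : Fin k → ℕ) (v : Fin k) :
    degreeOf v (∏ i, facPow (fun i => C (w i)) (X i) (c i) : MvPolynomial (Fin k) R) ≤ c v :=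
  calc _ ≤ ∑ i : Fin k, ∑ j ∈ range (c i), if i = v then 1 else 0 :=
        (degreeOf_prod_le _ _ _).trans (sum_le_sum fun i _ =>
          (degreeOf_prod_le _ _ _).trans (sum_le_sum fun j _ => degreeOf_X_sub_C_le _ _ _))
    _ = c v := by simp

/-- An entry occurs at most once in each column of a semistandard tableau. -/
lemma degreeOf_tabSum_le {k : ℕ} (w : ℕ → R) {p : Fin k → ℕ} {d : ℕ} (hp : ∀ i, p i ≤ d)
    (v : Fin k) : degreeOf v (tabSum X (fun i => C (w i)) p : MvPolynomial (Fin k) R) ≤ d := by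
  classical
  refine (degreeOf_sum_le _ _ _).trans (Finset.sup_le fun T hT => ?_)
  have hT' : IsSemistandard p T := (mem_filter.1 hT).2
  calc _ ≤ ∑ i : Fin k, ∑ j : Fin (p i), if T i j = v then 1 else 0 :=
        (degreeOf_prod_le _ _ _).trans (sum_le_sum fun i _ =>
          (degreeOf_prod_le _ _ _).trans (sum_le_sum fun j _ => degreeOf_X_sub_C_le _ _ _))
    _ = #{a : (i : Fin k) × Fin (p i) | T a.1 a.2 = v} := by
        rw [card_filter, ← univ_sigma_univ, sum_sigma]
    _ ≤ #(range d) := by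
        refine card_le_card_of_injOn (fun a => a.2.val)
          (fun a _ => by simpa using a.2.isLt.trans_le (hp a.1)) ?_
        rintro ⟨i, j⟩ h ⟨i', j'⟩ h' hjj
        simp only [coe_filter, mem_univ, true_and, Set.mem_ofPred_eq] at h h' hjj
        obtain hlt | rfl | hlt := lt_trichotomy i i'
        · have := hT'.2 i i' j (by omega) (by omega) hlt
          have e : (⟨j.val, by omega⟩ : Fin (p i')) = j' := Fin.ext hjj
          rw [e, h'] at this
          exact absurd h this.ne
        · rw [Fin.ext hjj]
        · have := hT'.2 i' i j (by omega) (by omega) hlt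
          have e : (⟨j.val, by omega⟩ : Fin (p i')) = j' := Fin.ext hjj
          rw [e, h'] at this
          exact absurd h this.ne'
    _ = d := card_range d

variable [IsDomain R]

lemma alternant_X_ne_zero {k : ℕ} (w : ℕ → MvPolynomial (Fin k) R) :
    alternant X w (betaNumber fun _ : Fin k => 0) ≠ 0 :=
  alternant_betaNumber_zero_ne_zero _ _ (X_injective (σ := Fin k) (R := R))

lemma tabSum_isSymmetric {k : ℕ} (w : ℕ → R) {p : Fin k → ℕ} (hp : Antitone p) :
    (tabSum X (fun i => C (w i)) p : MvPolynomial (Fin k) R).IsSymmetric := by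
  intro σ
  have h := tabSum_mul_alternant (X : Fin k → MvPolynomial (Fin k) R) (fun i => C (w i)) p hp
  have h' := congrArg (rename σ) h
  rw [map_mul, rename_alternant, rename_alternant, mul_smul_comm, ← h] at h'
  refine mul_right_cancel₀ (alternant_X_ne_zero (R := R) fun i => C (w i)) ?_
  rcases Int.units_eq_one_or (Equiv.Perm.sign σ) with hσ | hσ <;>
    simpa only [hσ, Units.val_one, one_smul, Units.val_neg, neg_smul, neg_inj] using h'

/-- A symmetric polynomial with degree less than `N - k + 1` in each variable is a combination of
the factorial Schur polynomials of partitions in the `k × (N - k)` box. -/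
theorem exists_eq_sum_tabSum {k N : ℕ} (w : ℕ → R) {f : MvPolynomial (Fin k) R}
    (hf : f.IsSymmetric) (hdeg : ∀ i, degreeOf i f + k ≤ N) :
    ∃ c : BoxPartition k N → R, f = ∑ g, c g • tabSum X (fun i => C (w i)) g.1 := by
  have h1 : f * alternant X (fun i => C (w i)) (betaNumber fun _ => 0) ∈ Submodule.span R
      (Set.range fun g : BoxPartition k N =>
        alternant X (fun i => C (w i)) (betaNumber g.1)) := by
    rw [← antisymmetrize_prod_facPow, ← antisymmetrize_mul hf]
    have hF : ∀ i, degreeOf i (f * ∏ i, facPow (fun i => C (w i)) (X i)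
        (betaNumber (fun _ : Fin k => 0) i)) < N := by
      intro i
      have h2 : degreeOf i (∏ i, facPow (fun i => C (w i)) (X i)
          (betaNumber (fun _ : Fin k => 0) i) : MvPolynomial (Fin k) R) ≤ k - 1 := by
        refine (degreeOf_prod_facPow_le w _ i).trans ?_
        simp only [betaNumber]
        omega
      have h3 := hdeg i
      have h4 := i.isLt
      exact (degreeOf_mul_le _ _ _).trans_lt (by omega)
    have h2 := Submodule.mem_map_of_mem (f := antisymmetrize k) (mem_span_prod_facPow w hF)
    rw [Submodule.map_span] at h2
    refine Submodule.span_le.2 ?_ h2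
    rintro _ ⟨_, ⟨c, hc, rfl⟩, rfl⟩
    rw [antisymmetrize_prod_facPow]
    exact alternant_mem_span hc
  obtain ⟨c, hc⟩ := (Submodule.mem_span_range_iff_exists_fun R).1 h1
  refine ⟨c, mul_right_cancel₀ (alternant_X_ne_zero (R := R) fun i => C (w i)) ?_⟩
  rw [← hc, sum_mul]
  exact sum_congr rfl fun g _ => by rw [smul_mul_assoc, tabSum_mul_alternant _ _ _ g.2.1]

end Expansion

/-! ### Factorial Schur polynomials as determinants of remainders -/

section Remainders

lemma antitone_colShape (k m : ℕ) : Antitone (colShape k m) := by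
  intro i j hij
  have h : i.val ≤ j.val := hij
  unfold colShape
  split_ifs <;> omega

lemma antitone_rowShape (k m : ℕ) : Antitone (rowShape k m) := by
  intro i j hij
  have h : i.val ≤ j.val := hij
  unfold rowShape
  split_ifs <;> omega

variable {A : Type*} [CommRing A] [IsDomain A]

/-- The generating identity of the factorial elementary symmetric polynomials, obtained by expanding
an alternant in the variables `x₁, …, x_k, y` along the row of `y`. -/
lemma prod_sub_eq_sum_facPow {k : ℕ} {x : Fin k → A} (hx : Function.Injective x) (w : ℕ → A)
    (y : A) : ∏ i, (y - x i) =
      ∑ j ∈ range (k + 1), (-1) ^ j * tabSum x w (colShape k j) * facPow w y (k - j) := by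
  refine mul_right_cancel₀ (alternant_betaNumber_zero_ne_zero x w hx) ?_
  have h := alternant_betaNumber_zero_succ (Fin.snoc (α := fun _ => A) x y) w
  simp only [Fin.snoc_castSucc, Fin.snoc_last] at h
  have h1 : ∏ i, (x i - y) = (-1) ^ k * ∏ i, (y - x i) := by
    rw [← Fin.prod_const, ← prod_mul_distrib]
    exact prod_congr rfl fun i _ => by ring
  have h2 : (-1 : A) ^ k * (-1) ^ k = 1 := by rw [← mul_pow]; simp
  rw [h1] at h
  have h3 : (∏ i, (y - x i)) * alternant x w (betaNumber fun _ => 0) = (-1) ^ k *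
      alternant (Fin.snoc (α := fun _ => A) x y) w (betaNumber fun _ => 0) := by
    rw [h]
    linear_combination (-(∏ i, (y - x i)) * alternant x w (betaNumber fun _ => 0)) * h2
  rw [h3, alternant, Matrix.det_succ_row _ (Fin.last k), sum_range, mul_sum, sum_mul]
  refine sum_congr rfl fun j _ => ?_
  have h4 : (Matrix.of fun (i j : Fin (k + 1)) => facPow w (Fin.snoc (α := fun _ => A) x y i)
      (betaNumber (fun _ => 0) j)).submatrix (Fin.last k).succAbove j.succAbove =
      Matrix.of fun i l => facPow w (x i) (betaNumber (colShape k j) l) := by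
    ext i l
    simp only [Matrix.submatrix_apply, Matrix.of_apply, Fin.succAbove_last, Fin.snoc_castSucc]
    congr 1
    simp only [betaNumber, colShape, Fin.succAbove, Fin.lt_def, Fin.val_castSucc]
    have := l.isLt
    split_ifs <;> simp only [Fin.val_castSucc, Fin.val_succ] <;> omega
  have h5 := tabSum_mul_alternant x w (colShape k j) (antitone_colShape k j)
  rw [h4]
  change _ * (_ * alternant x w (betaNumber (colShape k j))) = _
  rw [← h5]
  simp only [Matrix.of_apply, Fin.snoc_last, Fin.val_last, pow_add, betaNumber, zero_add,
    Nat.add_sub_cancel]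
  linear_combination ((-1) ^ j.val * facPow w y (k - j) * tabSum x w (colShape k j) *
    alternant x w (betaNumber fun _ => 0)) * h2

open Polynomial

variable {S : Type*} [CommRing S] (ι : S →+* A)

omit [IsDomain A] in
lemma det_eval₂_eq {k : ℕ} {x : Fin k → A} {M : S[X]} (hM : M.Monic) (hk : M.natDegree = k)
    (hroot : ∀ i, M.eval₂ ι (x i) = 0) (F : Fin k → S[X]) :
    (Matrix.of fun i j => (F j).eval₂ ι (x i)).det =
      ι (Matrix.of fun (l j : Fin k) => (F j %ₘ M).coeff (k - 1 - l.val)).det *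
        alternant x 0 (betaNumber fun _ => 0) := by
  rw [RingHom.map_det, mul_comm, alternant, ← Matrix.det_mul]
  congr 1
  ext i j
  rw [Matrix.mul_apply, Matrix.of_apply]
  have h1 : (F j).eval₂ ι (x i) = (F j %ₘ M).eval₂ ι (x i) := by
    conv_lhs => rw [← modByMonic_add_div (F j) M]
    rw [eval₂_add, eval₂_mul, hroot, zero_mul, add_zero]
  have h2 : (F j %ₘ M).natDegree < k := by
    rcases subsingleton_or_nontrivial S with hS | hS
    · rw [Subsingleton.elim (F j %ₘ M) 0, natDegree_zero]
      exact i.pos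
    rw [← hk]
    refine natDegree_modByMonic_lt _ hM fun h => ?_
    rw [h, natDegree_one] at hk
    exact absurd i.isLt (by omega)
  rw [h1, eval₂_eq_sum_range' ι h2, ← sum_range_reflect, sum_range]
  exact sum_congr rfl fun l _ => by simp [facPow, betaNumber, mul_comm]

/-- The Jacobi–Trudi formula for factorial Schur polynomials, in terms of remainders modulo a monic
polynomial `M` with roots `x₁, …, x_k`. -/
lemma tabSum_eq_det_coeff {k : ℕ} {x : Fin k → A} (hx : Function.Injective x) {M : S[X]}
    (hM : M.Monic) (hk : M.natDegree = k) (hroot : ∀ i, M.eval₂ ι (x i) = 0) (w : ℕ → S)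
    {p : Fin k → ℕ} (hp : Antitone p) :
    tabSum x (fun i => ι (w i)) p = ι (Matrix.of fun (l j : Fin k) =>
      (facPow (fun i => C (w i)) X (betaNumber p j) %ₘ M).coeff (k - 1 - l.val)).det := by
  refine mul_right_cancel₀ (alternant_betaNumber_zero_ne_zero x (fun i => ι (w i)) hx) ?_
  rw [tabSum_mul_alternant _ _ _ hp, alternant_betaNumber_zero_eq x _ 0,
    ← det_eval₂_eq ι hM hk hroot, alternant]
  congr 1
  ext i j
  simp [facPow, eval₂_finsetProd]

lemma tabSum_rowShape_eq_coeff {k : ℕ} [Nontrivial S] (h0 : 0 < k) {x : Fin k → A}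
    (hx : Function.Injective x) {M : S[X]} (hM : M.Monic) (hk : M.natDegree = k)
    (hroot : ∀ i, M.eval₂ ι (x i) = 0) (w : ℕ → S) (m : ℕ) :
    tabSum x (fun i => ι (w i)) (rowShape k m) =
      ι ((facPow (fun i => C (w i)) X (m + (k - 1)) %ₘ M).coeff (k - 1)) := by
  obtain ⟨k, rfl⟩ : ∃ k', k = k' + 1 := ⟨k - 1, by omega⟩
  rw [tabSum_eq_det_coeff ι hx hM hk hroot w (antitone_rowShape _ m)]
  have hself : ∀ j : Fin k, facPow (fun i => C (w i)) X (betaNumber (rowShape (k + 1) m) j.succ) %ₘ M =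
      facPow (fun i => C (w i)) X (k - 1 - j.val) := by
    intro j
    have e : betaNumber (rowShape (k + 1) m) j.succ = k - 1 - j.val := by
      simp [betaNumber, rowShape]
      omega
    rw [e, modByMonic_eq_self_iff hM]
    apply degree_lt_degree
    rw [(facPow_X_monic_natDegree w _).2, hk]
    omega
  rw [Matrix.det_of_isLowerTriangular, Fin.prod_univ_succ]
  · have h1 : ∀ j : Fin k, (facPow (fun i => C (w i)) X
        (betaNumber (rowShape (k + 1) m) j.succ) %ₘ M).coeff (k + 1 - 1 - j.succ.val) = 1 := by
      intro j
      have h := facPow_X_monic_natDegree w (k - 1 - j.val)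
      rw [hself, show k + 1 - 1 - j.succ.val = k - 1 - j.val by simp; omega]
      have h' := h.1.coeff_natDegree
      rwa [h.2] at h'
    simp only [Matrix.of_apply]
    rw [prod_congr rfl fun j _ => h1 j]
    simp [betaNumber, rowShape]
  · intro l j hlj
    have hlt : l < j := hlj
    induction j using Fin.cases with
    | zero => exact absurd hlt (Fin.not_lt_zero l)
    | succ j =>
      rw [Matrix.of_apply, hself]
      refine coeff_eq_zero_of_natDegree_lt ?_
      rw [(facPow_X_monic_natDegree w _).2]
      have h1 : l.val < j.val + 1 := hlt
      have h2 := j.isLt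
      omega

/-- If the top coefficients of the remainders of `Q, Q X, …, Q X^{k-1}` modulo a monic polynomial of
degree `k` lie in an ideal, so do all coefficients of the remainder of every multiple of `Q`. -/
lemma coeff_mul_modByMonic_mem {k : ℕ} {M : S[X]} (hM : M.Monic) (hk : M.natDegree = k)
    {I : Ideal S} {Q : S[X]} (hQ : ∀ j < k, ((Q * X ^ j) %ₘ M).coeff (k - 1) ∈ I) (G : S[X])
    (l : ℕ) : ((Q * G) %ₘ M).coeff l ∈ I := by
  let f := Ideal.Quotient.mk I
  have hM' : (M.map f).Monic := hM.map f
  have hzero : Q.map f %ₘ M.map f = 0 := by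
    by_contra hne
    set F := Q.map f %ₘ M.map f with hF
    have hnt : Nontrivial (S ⧸ I) := by
      by_contra h
      rw [not_nontrivial_iff_subsingleton] at h
      exact hne (Subsingleton.elim _ _)
    have hdeg : F.natDegree < k := by
      rw [← hk, ← hM.natDegree_map f]
      exact natDegree_lt_natDegree hne (degree_modByMonic_lt _ hM')
    -- `F X^{k-1-deg F}` has degree `k - 1`, hence is its own remainder.
    have h1 : (Q.map f * X ^ (k - 1 - F.natDegree)) %ₘ M.map f = F * X ^ (k - 1 - F.natDegree) := by
      have h2 : (F * X ^ (k - 1 - F.natDegree)) %ₘ M.map f = F * X ^ (k - 1 - F.natDegree) := by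
        rw [modByMonic_eq_self_iff hM']
        apply degree_lt_degree
        rw [natDegree_mul_X_pow _ hne, hM.natDegree_map f, hk]
        omega
      rw [← h2]
      refine modByMonic_eq_of_dvd_sub hM' ?_
      rw [← sub_mul, hF]
      refine Dvd.dvd.mul_right ?_ _
      rw [modByMonic_eq_sub_mul_div, sub_sub_cancel]
      exact dvd_mul_right _ _
    have h3 := Ideal.Quotient.eq_zero_iff_mem.2 (hQ (k - 1 - F.natDegree) (by omega))
    have h4 : f (((Q * X ^ (k - 1 - F.natDegree)) %ₘ M).coeff (k - 1)) = F.leadingCoeff := by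
      rw [← coeff_map, map_modByMonic f hM, Polynomial.map_mul, Polynomial.map_pow, map_X, h1]
      have h5 := coeff_mul_X_pow F (k - 1 - F.natDegree) F.natDegree
      rwa [show F.natDegree + (k - 1 - F.natDegree) = k - 1 by omega] at h5
    exact hne (leadingCoeff_eq_zero.1 (h4.symm.trans h3))
  rw [← Ideal.Quotient.eq_zero_iff_mem]
  change f _ = 0
  rw [← coeff_map, map_modByMonic f hM, Polynomial.map_mul, (modByMonic_eq_zero_iff_dvd hM').2
    (((modByMonic_eq_zero_iff_dvd hM').1 hzero).mul_right _), coeff_zero]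

lemma exists_monic_eval₂_eq_zero {k : ℕ} {x : Fin k → A} (hx : Function.Injective x)
    (hι : Function.Injective ι) (w : ℕ → S)
    (he : ∀ j ≤ k, ∃ e, ι e = tabSum x (fun i => ι (w i)) (colShape k j)) :
    ∃ M : S[X], M.Monic ∧ M.natDegree = k ∧ ∀ i, M.eval₂ ι (x i) = 0 := by
  choose e he using fun j : Fin (k + 1) => he j (Nat.lt_succ_iff.1 j.isLt)
  let M : S[X] := ∑ j : Fin (k + 1),
    C ((-1) ^ j.val * e j) * facPow (fun i => C (w i)) X (k - j)
  have hM : M.map ι = ∏ i : Fin k, (X - C (x i)) := by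
    rw [prod_sub_eq_sum_facPow (x := fun i => C (x i)) (C_injective.comp hx)
      (fun i => C (ι (w i))) X, sum_range, Polynomial.map_sum]
    refine sum_congr rfl fun j _ => ?_
    rw [← map_tabSum (C : A →+* A[X]), ← he j]
    simp [facPow, Polynomial.map_prod]
  have hmonic : M.Monic := by
    rw [hι.monic_map_iff, hM]
    exact monic_prod_of_monic _ _ fun i _ => monic_X_sub_C _
  refine ⟨M, hmonic, ?_, fun i => ?_⟩
  · rw [← natDegree_map_eq_of_injective hι, hM,
      natDegree_prod_of_monic _ _ fun i _ => monic_X_sub_C _]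
    simp
  · rw [← eval_map, hM, eval_prod]
    exact prod_eq_zero (mem_univ i) (by simp)

/-- A factorial Schur polynomial whose first row has more than `N - k` boxes lies in the ideal
generated by `h_{N-k+1}, …, h_N`. -/
lemma exists_mem_ideal_eq_tabSum {k N : ℕ} [Nontrivial S] (h0 : 0 < k) (hkN : k ≤ N)
    {x : Fin k → A} (hx : Function.Injective x) {M : S[X]} (hM : M.Monic) (hk : M.natDegree = k)
    (hroot : ∀ i, M.eval₂ ι (x i) = 0) {w : ℕ → S} (hw : ∀ i, N ≤ i → w i = 0) {I : Ideal S}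
    (hI : ∀ m, N - k + 1 ≤ m → m ≤ N → ∀ s, ι s = tabSum x (fun i => ι (w i)) (rowShape k m) →
      s ∈ I) {p : Fin k → ℕ} (hp : Antitone p) (hN : N ≤ betaNumber p ⟨0, h0⟩) :
    ∃ s ∈ I, ι s = tabSum x (fun i => ι (w i)) p := by
  have htop : ∀ j < k, ((facPow (fun i => C (w i)) X N * X ^ j) %ₘ M).coeff (k - 1) ∈ I := by
    intro j hj
    have h1 : facPow (fun i => C (w i)) X N * X ^ j =
        facPow (fun i => C (w i)) X (N - k + 1 + j + (k - 1)) := by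
      rw [← facPow_mul_prod_Ico _ _ (show N ≤ N - k + 1 + j + (k - 1) by omega)]
      congr 1
      have h2 : ∀ l ∈ Ico N (N - k + 1 + j + (k - 1)), (X - C (w l) : S[X]) = X := by
        intro l hl
        simp [hw l (mem_Ico.1 hl).1]
      rw [prod_congr rfl h2, prod_const, Nat.card_Ico]
      congr 1
      omega
    rw [h1]
    exact hI (N - k + 1 + j) (by omega) (by omega) _
      (tabSum_rowShape_eq_coeff ι h0 hx hM hk hroot w _).symm
  refine ⟨_, ?_, (tabSum_eq_det_coeff ι hx hM hk hroot w hp).symm⟩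
  rw [← Ideal.Quotient.eq_zero_iff_mem, RingHom.map_det]
  refine Matrix.det_eq_zero_of_column_eq_zero ⟨0, h0⟩ fun l => ?_
  rw [RingHom.mapMatrix_apply, Matrix.map_apply, Matrix.of_apply, Ideal.Quotient.eq_zero_iff_mem,
    ← facPow_mul_prod_Ico _ _ hN]
  exact coeff_mul_modByMonic_mem hM hk htop _ _

end Remainders

section Column

open MvPolynomial

variable {R : Type*} [CommRing R]

lemma alternant_mem_ideal {k : ℕ} {J : Ideal (MvPolynomial (Fin k) R)} {w : ℕ → R}
    {b : Fin k → ℕ} (j : Fin k)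
    (h : ∀ i, facPow (fun i => C (w i)) (X i) (b j) ∈ J) : alternant X (fun i => C (w i)) b ∈ J := by
  rw [← Ideal.Quotient.eq_zero_iff_mem, alternant, RingHom.map_det]
  refine Matrix.det_eq_zero_of_column_eq_zero j fun i => ?_
  rw [RingHom.mapMatrix_apply, Matrix.map_apply, Matrix.of_apply, Ideal.Quotient.eq_zero_iff_mem]
  exact h i

lemma facPow_X_mem_span {k N m : ℕ} (w : ℕ → R) (hN : N ≤ m) (i : Fin k) :
    facPow (fun i => C (w i)) (X i) m ∈ Ideal.span (Set.range fun i : Fin k =>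
      Polynomial.aeval (X i : MvPolynomial (Fin k) R)
        (facPow (fun i => Polynomial.C (w i)) Polynomial.X N)) := by
  rw [← facPow_mul_prod_Ico _ _ hN]
  exact Ideal.mul_mem_right _ _ (Ideal.subset_span ⟨i, aeval_facPow _ _ _⟩)

end Column

/-! ### The Schubert basis of the equivariant cohomology ring -/

section Presentation

open MvPolynomial

variable {R : Type*} [CommRing R] {k : ℕ}

/-- The `S`-submodule of `R[x₁, …, x_k]` generated by `h_{N-k+1}(x|w), …, h_N(x|w)`. -/
noncomputable def relSpan (S : Subalgebra R (MvPolynomial (Fin k) R)) (w : ℕ → R) (N : ℕ) :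
    Submodule S (MvPolynomial (Fin k) R) :=
  Submodule.span S {f | ∃ m, N - k + 1 ≤ m ∧ m ≤ N ∧
    f = tabSum X (fun i => C (w i)) (rowShape k m)}

/-- Multiplication by the Vandermonde alternant moves the relations into the ideal generated by the
`(x_i|w)^N`. -/
lemma mul_alternant_mem_of_mem_relSpan {N : ℕ} (hk : 0 < k)
    {S : Subalgebra R (MvPolynomial (Fin k) R)} {w : ℕ → R} {f : MvPolynomial (Fin k) R}
    (hf : f ∈ relSpan S w N) :
    f * alternant X (fun i => C (w i)) (betaNumber fun _ => 0) ∈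
      Ideal.span (Set.range fun i : Fin k => Polynomial.aeval (X i : MvPolynomial (Fin k) R)
        (facPow (fun i => Polynomial.C (w i)) Polynomial.X N)) := by
  induction hf using Submodule.span_induction with
  | mem f hf =>
    obtain ⟨m, hm, -, rfl⟩ := hf
    rw [tabSum_mul_alternant _ _ _ (antitone_rowShape k m)]
    refine alternant_mem_ideal ⟨0, hk⟩ fun i => facPow_X_mem_span _ ?_ i
    simp only [betaNumber, rowShape, if_true]
    omega
  | zero => rw [zero_mul]; exact Ideal.zero_mem _
  | add f g _ _ hf hg => rw [add_mul]; exact Ideal.add_mem _ hf hg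
  | smul s f _ hf =>
    rw [smul_mul_assoc, Algebra.smul_def]
    exact Ideal.mul_mem_left _ _ hf

variable [IsDomain R]

lemma tabSum_colShape_mem {S : Subalgebra R (MvPolynomial (Fin k) R)} {w : ℕ → R}
    (hS : ∀ j, 1 ≤ j → j ≤ k → tabSum X (fun i => C (w i)) (colShape k j) ∈ S) {j : ℕ}
    (hj : j ≤ k) : tabSum X (fun i => C (w i)) (colShape k j) ∈ S := by
  rcases Nat.eq_zero_or_pos j with rfl | hpos
  · have h : tabSum (X : Fin k → MvPolynomial (Fin k) R) (fun i => C (w i)) (colShape k 0) = 1 := by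
      have h2 : colShape k 0 = fun _ => 0 := by
        funext i
        simp [colShape]
      refine mul_right_cancel₀ (alternant_X_ne_zero (R := R) fun i => C (w i)) ?_
      rw [one_mul, tabSum_mul_alternant _ _ _ (antitone_colShape k 0), h2]
    rw [h]
    exact one_mem _
  · exact hS j hpos hj

lemma tabSum_mem_relSpan {N : ℕ} (hk : 0 < k) (hkN : k ≤ N)
    {S : Subalgebra R (MvPolynomial (Fin k) R)} {w : ℕ → R} (hw : ∀ i, N ≤ i → w i = 0)
    (hS : ∀ j, 1 ≤ j → j ≤ k → tabSum X (fun i => C (w i)) (colShape k j) ∈ S)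
    {p : Fin k → ℕ} (hp : Antitone p) (hbox : ¬ ∀ i, p i ≤ N - k) :
    tabSum X (fun i => C (w i)) p ∈ relSpan S w N := by
  let ι : S →+* MvPolynomial (Fin k) R := S.val.toRingHom
  have hX := X_injective (σ := Fin k) (R := R)
  have hN : N ≤ betaNumber p ⟨0, hk⟩ := by
    obtain ⟨i, hi⟩ := not_forall.1 hbox
    have h := hp (show (⟨0, hk⟩ : Fin k) ≤ i from Fin.le_def.2 (Nat.zero_le _))
    simp only [betaNumber]
    omega
  obtain ⟨M, hM, hdeg, hroot⟩ := exists_monic_eval₂_eq_zero ι hX Subtype.val_injective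
    (fun i => algebraMap R S (w i)) fun j hj => ⟨⟨_, tabSum_colShape_mem hS hj⟩, rfl⟩
  obtain ⟨s, hs, hsp⟩ := exists_mem_ideal_eq_tabSum ι hk hkN hX hM hdeg hroot
    (w := fun i => algebraMap R S (w i)) (fun i hi => by rw [hw i hi, map_zero])
    (I := (relSpan S w N).comap (Algebra.linearMap S (MvPolynomial (Fin k) R)))
    (fun m hm hm' s hs => Submodule.subset_span ⟨m, hm, hm', hs⟩) hp hN
  have hsp' : tabSum X (fun i => C (w i)) p = ι s := hsp.symm
  rw [hsp']
  exact hs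

lemma exists_sub_sum_mem_relSpan {N : ℕ} (hk : 0 < k) (hkN : k ≤ N)
    {S : Subalgebra R (MvPolynomial (Fin k) R)} {w : ℕ → R} (hw : ∀ i, N ≤ i → w i = 0)
    (hS : ∀ j, 1 ≤ j → j ≤ k → tabSum X (fun i => C (w i)) (colShape k j) ∈ S)
    {f : MvPolynomial (Fin k) R} (hf : f.IsSymmetric) :
    ∃ c : BoxPartition k N → R,
      f - ∑ g, c g • tabSum X (fun i => C (w i)) g.1 ∈ relSpan S w N := by
  obtain ⟨c, hc⟩ := exists_eq_sum_tabSum (N := ∑ i, degreeOf i f + k) w hf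
    fun i => Nat.add_le_add_right
      (single_le_sum (f := fun i => degreeOf i f) (fun _ _ => Nat.zero_le _) (mem_univ i)) k
  have hmem : f ∈ Submodule.span R
      (Set.range fun g : BoxPartition k N => tabSum X (fun i => C (w i)) g.1) ⊔
        (relSpan S w N).restrictScalars R := by
    rw [hc]
    refine Submodule.sum_mem _ fun g _ => Submodule.smul_mem _ _ ?_
    by_cases hg : ∀ i, g.1 i ≤ N - k
    · exact Submodule.mem_sup_left (Submodule.subset_span ⟨⟨g.1, g.2.1, hg⟩, rfl⟩)
    · exact Submodule.mem_sup_right (tabSum_mem_relSpan hk hkN hw hS g.2.1 hg)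
  obtain ⟨y, hy, z, hz, hyz⟩ := Submodule.mem_sup.1 hmem
  obtain ⟨c', rfl⟩ := (Submodule.mem_span_range_iff_exists_fun _).1 hy
  exact ⟨c', by rwa [← hyz, add_sub_cancel_left]⟩

lemma eq_of_sub_sum_mem_relSpan {N : ℕ} (hk : 0 < k) (hkN : k ≤ N)
    {S : Subalgebra R (MvPolynomial (Fin k) R)} {w : ℕ → R} {f : MvPolynomial (Fin k) R}
    {c c' : BoxPartition k N → R}
    (hc : f - ∑ g, c g • tabSum X (fun i => C (w i)) g.1 ∈ relSpan S w N)
    (hc' : f - ∑ g, c' g • tabSum X (fun i => C (w i)) g.1 ∈ relSpan S w N) : c = c' := by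
  have h := mul_alternant_mem_of_mem_relSpan hk ((relSpan S w N).sub_mem hc' hc)
  rw [sub_sub_sub_cancel_left, ← sum_sub_distrib, sum_mul] at h
  have hQ := facPow_X_monic_natDegree w N
  refine sub_eq_zero.1 (eq_zero_of_sum_alternant_mem hkN w hQ.1 hQ.2 (c - c') ?_)
  have e : ∀ g : BoxPartition k N, (c g • tabSum X (fun i => C (w i)) g.1 -
      c' g • tabSum X (fun i => C (w i)) g.1) * alternant X (fun i => C (w i))
        (betaNumber fun _ => 0) =
      C ((c - c') g) * alternant X (fun i => C (w i)) (betaNumber g.1) := fun g => by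
    rw [← sub_smul, smul_mul_assoc, tabSum_mul_alternant _ _ _ g.2.1, smul_eq_C_mul, Pi.sub_apply]
  rwa [sum_congr rfl fun g _ => e g] at h

end Presentation

section StructureConstants

variable {k N n : ℕ}

lemma isProductExpansion_iff {a b : BoxPartition k N} {c : BoxPartition k N → TorusRing N} :
    IsProductExpansion a b c ↔
      tabSum MvPolynomial.X (fun i => MvPolynomial.C (weight N i)) a.1 *
        tabSum MvPolynomial.X (fun i => MvPolynomial.C (weight N i)) b.1 -
        ∑ g : BoxPartition k N, c g • tabSum MvPolynomial.X (fun i => MvPolynomial.C (weight N i)) g.1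
          ∈ relSpan (symRing k N) (weight N) N :=
  Iff.rfl

/-- The product of two Schubert classes has exactly one expansion in Schubert classes. -/
theorem existsUnique_isProductExpansion (hk : 0 < k) (hkN : k ≤ N) (a b : BoxPartition k N) :
    ∃! c, IsProductExpansion a b c := by
  simp only [isProductExpansion_iff]
  obtain ⟨c, hc⟩ := exists_sub_sum_mem_relSpan (S := symRing k N) (w := weight N) hk hkN
    (fun i hi => dif_neg (not_lt.2 hi))
    (fun j h1 h2 => Algebra.subset_adjoin ⟨j, h1, h2, rfl⟩)
    ((tabSum_isSymmetric (weight N) a.2.1).mul (tabSum_isSymmetric (weight N) b.2.1))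
  exact ⟨c, hc, fun c' hc' => eq_of_sub_sum_mem_relSpan hk hkN hc' hc⟩

/-- If both factors lie in the smaller box, their degrees are so small that no relation is needed to
expand their product. -/
lemma tabSum_mul_tabSum_eq_sum (hk : 0 < k) (hkn : k < n) (a b : BoxPartition k n) :
    tabSum MvPolynomial.X (fun i => MvPolynomial.C (weight (2 * n - 1) i)) a.1 *
      tabSum MvPolynomial.X (fun i => MvPolynomial.C (weight (2 * n - 1) i)) b.1 =
      ∑ g : BoxPartition k (2 * n - 1), structureConst a.lift b.lift g •
        tabSum MvPolynomial.X (fun i => MvPolynomial.C (weight (2 * n - 1) i)) g.1 := by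
  obtain ⟨c, hc⟩ := exists_eq_sum_tabSum (N := 2 * n - 1) (weight (2 * n - 1))
    ((tabSum_isSymmetric (weight (2 * n - 1)) a.2.1).mul
      (tabSum_isSymmetric (weight (2 * n - 1)) b.2.1))
    fun i => by
      have h1 := degreeOf_tabSum_le (weight (2 * n - 1)) a.2.2 i
      have h2 := degreeOf_tabSum_le (weight (2 * n - 1)) b.2.2 i
      have h3 := MvPolynomial.degreeOf_mul_le i
        (tabSum MvPolynomial.X (fun i => MvPolynomial.C (weight (2 * n - 1) i)) a.1)
        (tabSum MvPolynomial.X (fun i => MvPolynomial.C (weight (2 * n - 1) i)) b.1)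
      omega
  have h : IsProductExpansion a.lift b.lift c :=
    isProductExpansion_iff.2 (Set.mem_of_eq_of_mem (sub_eq_zero.2 hc) (Submodule.zero_mem _))
  have hex := existsUnique_isProductExpansion hk (show k ≤ 2 * n - 1 by omega) a.lift b.lift
  have hs : structureConst a.lift b.lift = c := hex.unique (Classical.epsilon_spec ⟨c, h⟩) h
  rw [hs]
  exact hc

end StructureConstants

/-! ### Rim hooks and beta numbers -/

section RimHooks

variable {k n : ℕ}

lemma RemovesRimHook.le_apply {p p' : Fin k → ℕ} {e : ℕ} (hp : Antitone p)
    (h : RemovesRimHook n p p' e) : p' ≤ p := by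
  obtain ⟨hp', r, s, hrs, -, hout, hin, hs⟩ := h
  intro i
  change p' i ≤ p i
  by_cases hi : i < r ∨ s < i
  · exact (hout i hi).le
  · rw [not_or, not_lt, not_lt] at hi
    rcases hi.2.eq_or_lt with rfl | hlt
    · rcases hi.1.eq_or_lt with rfl | hlt'
      · omega
      · have h1 : r.val < i.val := hlt'
        have h2 := hin ⟨i.val - 1, by omega⟩ i (Fin.le_def.2 (by simp; omega)) le_rfl
          (by simp; omega)
        have h3 : p' i ≤ p' ⟨i.val - 1, by omega⟩ := hp' (Fin.le_def.2 (by simp))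
        omega
    · have h1 : i.val < s.val := hlt
      have h2 := s.isLt
      have h3 := hin i ⟨i.val + 1, by omega⟩ hi.1 (Fin.le_def.2 (by simp; omega)) rfl
      have h4 : p ⟨i.val + 1, by omega⟩ ≤ p i := hp (Fin.le_def.2 (by simp))
      omega

lemma RemovesRimHook.sum_lt (hn : 0 < n) {p p' : Fin k → ℕ} {e : ℕ} (hp : Antitone p)
    (h : RemovesRimHook n p p' e) : ∑ i, p' i < ∑ i, p i := by
  have hle := h.le_apply hp
  obtain ⟨hp', r, s, hrs, -, hout, hin, hs⟩ := h
  refine sum_lt_sum (fun i _ => hle i) ⟨s, mem_univ s, ?_⟩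
  rcases hrs.eq_or_lt with rfl | hlt
  · omega
  · have h1 : r.val < s.val := hlt
    have h2 := hin ⟨s.val - 1, by omega⟩ s (Fin.le_def.2 (by simp; omega)) le_rfl (by simp; omega)
    have h3 : p' s ≤ p' ⟨s.val - 1, by omega⟩ := hp' (Fin.le_def.2 (by simp))
    omega

lemma exists_rimHookReduces (hn : 0 < n) {p : Fin k → ℕ} (hp : Antitone p) :
    ∃ es q, RimHookReduces n p es q ∧ IsCore n q := by
  induction hsum : ∑ i, p i using Nat.strong_induction_on generalizing p with
  | _ m ih =>
    by_cases hcore : IsCore n p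
    · exact ⟨[], p, .nil p, hcore⟩
    · obtain ⟨q, e, hq⟩ := not_not.1 hcore
      obtain ⟨es, q', h1, h2⟩ := ih _ (hsum ▸ hq.sum_lt hn hp) hq.1 rfl
      exact ⟨e :: es, q', .cons hq h1, h2⟩

/-- Removing an `n`-rim hook subtracts `n` from one beta number and moves it past `s - r` others. -/
lemma RemovesRimHook.betaNumber_eq {p p' : Fin k → ℕ} {e : ℕ} (h : RemovesRimHook n p p' e) :
    ∃ r s : Fin k, r ≤ s ∧ e = s.val - r.val + 1 ∧ n ≤ betaNumber p r ∧ betaNumber p' =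
      Function.update (betaNumber p) r (betaNumber p r - n) ∘ Fin.cycleIcc r s := by
  obtain ⟨-, r, s, hrs, he, hout, hin, hs⟩ := h
  have h1 : r.val ≤ s.val := hrs
  have h2 := s.isLt
  refine ⟨r, s, hrs, he, by simp only [betaNumber]; omega, funext fun i => ?_⟩
  have : NeZero k := ⟨by omega⟩
  rw [Function.comp_apply]
  rcases lt_or_ge i r with hi | hi
  · rw [Fin.cycleIcc_of_lt hi, Function.update_of_ne hi.ne]
    simp only [betaNumber, hout i (Or.inl hi)]
  rcases lt_trichotomy i s with hi' | rfl | hi'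
  · have h3 : i.val < s.val := hi'
    have h4 : r.val ≤ i.val := hi
    have h5 : (i + 1 : Fin k).val = i.val + 1 := Fin.val_add_one_of_lt' (by omega)
    rw [Fin.cycleIcc_of_ge_of_lt hi hi', Function.update_of_ne
      (fun h => by have := congrArg Fin.val h; omega)]
    have h6 := hin i (i + 1) hi (Fin.le_def.2 (by omega)) h5
    simp only [betaNumber, h5]
    omega
  · rw [Fin.cycleIcc_of_last hi, Function.update_self]
    simp only [betaNumber]
    omega
  · rw [Fin.cycleIcc_of_gt hi', Function.update_of_ne (hrs.trans_lt hi').ne']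
    simp only [betaNumber, hout i (Or.inr hi')]

/-- In an `n`-core that does not fit into the box, the first beta number exceeds another one by
exactly `n`. -/
lemma IsCore.exists_betaNumber_add_eq (hn : 0 < n) (hk : 0 < k) (hkn : k ≤ n) {p : Fin k → ℕ}
    (hp : Antitone p) (hcore : IsCore n p) (hbox : ¬ ∀ i, p i ≤ n - k) :
    ∃ j : Fin k, betaNumber p j + n = betaNumber p ⟨0, hk⟩ := by
  by_contra! hne
  set o : Fin k := ⟨0, hk⟩
  have ho0 : o.val = 0 := rfl
  have hbig : n ≤ betaNumber p o := by
    obtain ⟨i, hi⟩ := not_forall.1 hbox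
    have h := hp (show o ≤ i from Fin.le_def.2 (Nat.zero_le _))
    simp only [betaNumber]
    omega
  -- `s` is the last row whose beta number exceeds that of the first row lowered by `n`.
  obtain ⟨s, hs, hmax⟩ := exists_max_image
    ({i : Fin k | betaNumber p o < betaNumber p i + n} : Finset (Fin k)) id
    ⟨o, mem_filter.2 ⟨mem_univ _, by omega⟩⟩
  have hs : betaNumber p o < betaNumber p s + n := (mem_filter.1 hs).2
  have hgt : ∀ i, s < i → betaNumber p i + n < betaNumber p o := fun i hi => by
    have h1 : ¬ betaNumber p o < betaNumber p i + n := fun h =>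
      absurd (hmax i (mem_filter.2 ⟨mem_univ _, h⟩)) (not_le.2 hi)
    have h2 := hne i
    omega
  have hsk := s.isLt
  -- If row `s` were empty, the beta numbers from row `s` on would be all of `0, …, k - 1 - s`,
  -- including that of the first row lowered by `n`.
  have hpos : s ≠ o → 1 ≤ p s := by
    intro hso
    by_contra h0
    have hj : k - 1 - (betaNumber p o - n) < k := by omega
    have h1 : betaNumber p s = k - 1 - s.val := by simp only [betaNumber]; omega
    have h2 : p ⟨_, hj⟩ ≤ p s := hp (Fin.le_def.2 (by simp only; omega))
    have h3 := hne ⟨_, hj⟩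
    have h4 : betaNumber p ⟨_, hj⟩ = p ⟨_, hj⟩ + (k - 1 - (k - 1 - (betaNumber p o - n))) := rfl
    omega
  have hs' : n ≤ p o + s.val ∧ ∀ j : Fin k, j.val = s.val + 1 → p j + n ≤ p o + s.val := by
    by_cases hlast : s.val + 1 < k
    · have h := hgt ⟨s.val + 1, hlast⟩ (Fin.lt_def.2 (by simp))
      simp only [betaNumber, ho0] at h
      refine ⟨by omega, fun j hj => ?_⟩
      obtain rfl : j = ⟨s.val + 1, hlast⟩ := Fin.ext hj
      omega
    · simp only [betaNumber, ho0] at hbig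
      exact ⟨by omega, fun j hj => absurd j.isLt (by omega)⟩
  -- `q` is what is left of `p` after removing a rim hook in the rows up to `s`.
  let q : Fin k → ℕ := fun i => if h : i.val < s.val then p ⟨i.val + 1, by omega⟩ - 1 else
    if i = s then p o + s.val - n else p i
  have hq1 : ∀ (i j : Fin k), i.val < s.val → j.val = i.val + 1 → q i = p j - 1 := by
    intro i j hi hj
    have e : j = ⟨i.val + 1, by omega⟩ := Fin.ext hj
    rw [e]
    exact dif_pos hi
  have hq2 : q s = p o + s.val - n := by simp [q]
  have hq3 : ∀ i, s < i → q i = p i := fun i hi => by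
    have h1 : s.val < i.val := hi
    simp only [q, dif_neg (not_lt.2 h1.le), if_neg hi.ne']
  have hqanti : Antitone q := by
    obtain ⟨k, rfl⟩ : ∃ k', k = k' + 1 := ⟨k - 1, by omega⟩
    rw [Fin.antitone_iff_succ_le]
    intro i
    have hi := i.isLt
    have e1 : i.succ.val = i.val + 1 := rfl
    have e2 : i.castSucc.val = i.val := rfl
    rcases lt_trichotomy i.succ s with h | h | h
    · have h' : i.val + 1 < s.val := h
      rw [hq1 i.castSucc i.succ (by omega) (by omega), hq1 i.succ ⟨i.val + 2, by omega⟩ h' rfl]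
      have : p ⟨i.val + 2, by omega⟩ ≤ p i.succ := hp (Fin.le_def.2 (by simp))
      omega
    · have h' : i.val + 1 = s.val := congrArg Fin.val h
      rw [hq1 i.castSucc i.succ (by omega) (by omega), h, hq2]
      simp only [betaNumber, ho0] at hs
      omega
    · have h' : s.val < i.val + 1 := h
      rw [hq3 _ h]
      rcases (Nat.lt_succ_iff.1 h').eq_or_lt with h2 | h2
      · obtain rfl : s = i.castSucc := Fin.ext h2
        rw [hq2]
        have := hs'.2 i.succ rfl
        omega
      · rw [hq3 _ (Fin.lt_def.2 h2)]
        exact hp i.castSucc_lt_succ.le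
  refine hcore ⟨q, s.val - o.val + 1, hqanti, o, s, Fin.le_def.2 (Nat.zero_le _), rfl, ?_, ?_, ?_⟩
  · rintro i (hi | hi)
    · exact absurd hi (not_lt.2 (Fin.le_def.2 (Nat.zero_le _)))
    · exact hq3 i hi
  · intro i j _ hjs hj
    have h1 : j.val ≤ s.val := hjs
    rw [hq1 i j (by omega) hj]
    have h2 : p s ≤ p j := hp hjs
    have h3 := hpos fun h => by
      have := congrArg Fin.val h
      omega
    omega
  · rw [hq2]
    omega

end RimHooks

/-! ### Rim hook removal and alternants -/

section Reduction

variable {B : Type*} [CommRing B] {k n : ℕ} {x : Fin k → B} {u : ℕ → B} {κ : B}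

lemma alternant_eq_mul_update (H : ∀ i m, facPow u (x i) (m + n) = κ * facPow u (x i) m)
    {b : Fin k → ℕ} {r : Fin k} (hr : n ≤ b r) :
    alternant x u b = κ * alternant x u (Function.update b r (b r - n)) := by
  set M : Matrix (Fin k) (Fin k) B :=
    Matrix.of fun i j => facPow u (x i) (Function.update b r (b r - n) j) with hM
  have h : (Matrix.of fun i j => facPow u (x i) (b j)) = M.updateCol r (κ • fun i => M i r) := by
    ext i j
    rcases eq_or_ne j r with rfl | hj
    · simp [hM, ← H, Nat.sub_add_cancel hr]
    · simp [hM, Matrix.updateCol_ne hj, Function.update_of_ne hj]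
  rw [alternant, alternant, h, Matrix.det_updateCol_smul, ← hM]
  congr 2
  exact Matrix.updateCol_eq_self M r

lemma RemovesRimHook.alternant_eq (H : ∀ i m, facPow u (x i) (m + n) = κ * facPow u (x i) m)
    {p p' : Fin k → ℕ} {e : ℕ} (h : RemovesRimHook n p p' e) :
    alternant x u (betaNumber p) = (-1) ^ (e + 1) * κ * alternant x u (betaNumber p') := by
  obtain ⟨r, s, hrs, rfl, hn, hb⟩ := h.betaNumber_eq
  rw [hb, alternant_comp_perm, Fin.sign_cycleIcc_of_le hrs, alternant_eq_mul_update H hn]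
  have h2 : (-1 : B) ^ (s.val - r.val) * (-1) ^ (s.val - r.val) = 1 := by rw [← mul_pow]; simp
  simp only [Units.val_pow_eq_pow_val, Units.val_neg, Units.val_one, zsmul_eq_mul, Int.cast_pow,
    Int.cast_neg, Int.cast_one, pow_add, pow_one]
  linear_combination (-κ * alternant x u
    (Function.update (betaNumber p) r (betaNumber p r - n))) * h2

lemma RimHookReduces.alternant_eq (H : ∀ i m, facPow u (x i) (m + n) = κ * facPow u (x i) m)
    {p q : Fin k → ℕ} {es : List ℕ} (h : RimHookReduces n p es q) :
    alternant x u (betaNumber p) =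
      (es.map fun e => (-1) ^ (e + 1) * κ).prod * alternant x u (betaNumber q) := by
  induction h with
  | nil p => simp
  | cons h _ ih => rw [h.alternant_eq H, ih, List.map_cons, List.prod_cons]; ring

lemma RimHookReduces.antitone {p q : Fin k → ℕ} {es : List ℕ} (h : RimHookReduces n p es q)
    (hp : Antitone p) : Antitone q := by
  induction h with
  | nil p => exact hp
  | cons h _ ih => exact ih h.1

lemma IsCore.alternant_eq_zero (H : ∀ i m, facPow u (x i) (m + n) = κ * facPow u (x i) m)
    (hn : 0 < n) (hk : 0 < k) (hkn : k ≤ n) {p : Fin k → ℕ} (hp : Antitone p) (hcore : IsCore n p)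
    (hbox : ¬ ∀ i, p i ≤ n - k) : alternant x u (betaNumber p) = 0 := by
  obtain ⟨j, hj⟩ := hcore.exists_betaNumber_add_eq hn hk hkn hp hbox
  have hj0 : j ≠ ⟨0, hk⟩ := fun h => by
    rw [h] at hj
    omega
  rw [alternant_eq_mul_update H (r := ⟨0, hk⟩) (by omega),
    GrassRimHook.alternant_eq_zero x u hj0, mul_zero]
  rw [Function.update_of_ne hj0, Function.update_self]
  omega

end Reduction

/-! ### The quotient by `(x_i|u)^n = κ` -/

section Quantum

open MvPolynomial

variable {R : Type*} [CommRing R] {k n : ℕ}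

/-- The ideal of `R[x₁, …, x_k]` generated by the polynomials `(x_i|u)^n - κ`. -/
noncomputable def quantumIdeal (k : ℕ) (u : ℕ → R) (n : ℕ) (κ : R) :
    Ideal (MvPolynomial (Fin k) R) :=
  Ideal.span (Set.range fun i : Fin k => Polynomial.aeval (X i : MvPolynomial (Fin k) R)
    (facPow (fun i => Polynomial.C (u i)) Polynomial.X n - Polynomial.C κ))

/-- The linear map to the quotient by `quantumIdeal` that sends the basis element of a partition to
the class of its alternant. -/
noncomputable def alternantClass (k n : ℕ) (u : ℕ → R) (κ : R) :
    (BoxPartition k n → R) →ₗ[R] MvPolynomial (Fin k) R ⧸ quantumIdeal k u n κ :=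
  Fintype.linearCombination R fun g => Ideal.Quotient.mkₐ R (quantumIdeal k u n κ)
    (alternant X (fun i => C (u i)) (betaNumber g.1))

/-- The linear map to the quotient by `quantumIdeal` that sends the basis element of a partition to
the class of its factorial Schur polynomial. -/
noncomputable def schurClass (k n : ℕ) (u : ℕ → R) (κ : R) :
    (BoxPartition k n → R) →ₗ[R] MvPolynomial (Fin k) R ⧸ quantumIdeal k u n κ :=
  Fintype.linearCombination R fun g => Ideal.Quotient.mkₐ R (quantumIdeal k u n κ)
    (tabSum X (fun i => C (u i)) g.1)

lemma alternantClass_eq (u : ℕ → R) (κ : R) (v : BoxPartition k n → R) :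
    alternantClass k n u κ v = schurClass k n u κ v *
      Ideal.Quotient.mkₐ R (quantumIdeal k u n κ)
        (alternant X (fun i => C (u i)) (betaNumber fun _ => 0)) := by
  simp only [alternantClass, schurClass, Fintype.linearCombination_apply, sum_mul]
  exact sum_congr rfl fun g _ => by
    rw [smul_mul_assoc, ← map_mul, tabSum_mul_alternant _ _ _ g.2.1]

/-- The map is injective because alternants of partitions in the box are linearly independent modulo
a monic polynomial of degree `n` in each variable. -/
lemma alternantClass_injective [IsDomain R] (hn : 0 < n) (hkn : k ≤ n) (u : ℕ → R) (κ : R) :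
    Function.Injective (alternantClass k n u κ) := by
  rw [← LinearMap.ker_eq_bot, LinearMap.ker_eq_bot']
  intro v hv
  have hQ := facPow_X_monic_natDegree u n
  have hdeg : (Polynomial.C κ).degree <
      (facPow (fun i => Polynomial.C (u i)) (Polynomial.X : Polynomial R) n).degree := by
    rw [Polynomial.degree_eq_natDegree hQ.1.ne_zero, hQ.2]
    exact Polynomial.degree_C_le.trans_lt (by exact_mod_cast hn)
  refine eq_zero_of_sum_alternant_mem hkn u (hQ.1.sub_of_left hdeg)
    ((Polynomial.natDegree_sub_C).trans hQ.2) v ?_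
  change _ ∈ quantumIdeal k u n κ
  rw [← Ideal.Quotient.eq_zero_iff_mem, ← Ideal.Quotient.mkₐ_eq_mk R, ← hv, map_sum, alternantClass,
    Fintype.linearCombination_apply]
  exact sum_congr rfl fun g _ => by rw [← smul_eq_C_mul, map_smul]

lemma facPow_add_of_periodic {B : Type*} [CommRing B] {u : ℕ → B} (hu : ∀ i, u (i + n) = u i)
    (x : B) (m : ℕ) : facPow u x (m + n) = facPow u x n * facPow u x m := by
  rw [facPow, add_comm, prod_range_add]
  congr 1
  exact prod_congr rfl fun i _ => by rw [add_comm, hu]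

lemma facPow_mk_add {u : ℕ → R} (hu : ∀ i, u (i + n) = u i) (κ : R) (i : Fin k) (m : ℕ) :
    facPow (fun i => Ideal.Quotient.mkₐ R (quantumIdeal k u n κ) (C (u i)))
        (Ideal.Quotient.mkₐ R (quantumIdeal k u n κ) (X i)) (m + n) =
      algebraMap R _ κ *
        facPow (fun i => Ideal.Quotient.mkₐ R (quantumIdeal k u n κ) (C (u i)))
          (Ideal.Quotient.mkₐ R (quantumIdeal k u n κ) (X i)) m := by
  rw [facPow_add_of_periodic fun i => by rw [hu]]
  congr 1
  have h1 := map_facPow (Ideal.Quotient.mk (quantumIdeal k u n κ)) (fun i => C (u i)) (X i) n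
  refine h1.symm.trans ?_
  refine Ideal.Quotient.eq.2 (Ideal.subset_span ⟨i, ?_⟩)
  simp only [map_sub, aeval_facPow, Polynomial.aeval_C, algebraMap_eq]

lemma mk_alternant (u : ℕ → R) (κ : R) (b : Fin k → ℕ) :
    Ideal.Quotient.mkₐ R (quantumIdeal k u n κ) (alternant X (fun i => C (u i)) b) =
      alternant (fun i => Ideal.Quotient.mkₐ R (quantumIdeal k u n κ) (X i))
        (fun i => Ideal.Quotient.mkₐ R (quantumIdeal k u n κ) (C (u i))) b :=
  map_alternant (Ideal.Quotient.mk (quantumIdeal k u n κ)) _ _ _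

end Quantum

/-! ### The reduction map and the product -/

section Product

open MvPolynomial

variable {k n : ℕ}

/-- The weights `t_{i mod n}`, as elements of `Λ_n[q]`. -/
noncomputable def cyclicWeight (n : ℕ) (hn : 0 < n) (i : ℕ) : Polynomial (TorusRing n) :=
  Polynomial.C (X ⟨i % n, Nat.mod_lt i hn⟩)

lemma cyclicWeight_add (hn : 0 < n) (i : ℕ) : cyclicWeight n hn (i + n) = cyclicWeight n hn i := by
  simp [cyclicWeight]

/-- The element `(-1)^{k-1} q` of `Λ_n[q]`. -/
noncomputable def signedQ (k n : ℕ) : Polynomial (TorusRing n) := (-1) ^ (k + 1) * Polynomial.X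

lemma prod_sign_smul {R B : Type*} [CommRing R] [CommRing B] [Algebra R B] (es : List ℕ) (k : ℕ)
    (q : R) (y : B) : (es.map fun e => (-1) ^ (e + k) * q).prod • y =
      (es.map fun e => (-1) ^ (e + 1) * algebraMap R B ((-1) ^ (k + 1) * q)).prod * y := by
  rw [Algebra.smul_def]
  congr 1
  rw [map_list_prod, List.map_map]
  congr 2
  funext e
  simp only [Function.comp_apply, map_mul, map_pow, map_neg, map_one]
  rw [← mul_assoc, ← pow_add, show e + 1 + (k + 1) = e + k + 2 by ring, pow_add _ (e + k) 2,
    neg_one_sq, mul_one]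

lemma alternantClass_schubert (hn : 0 < n) (p : BoxPartition k n) :
    alternantClass k n (cyclicWeight n hn) (signedQ k n) (schubert p) =
      Ideal.Quotient.mkₐ (Polynomial (TorusRing n)) (quantumIdeal k (cyclicWeight n hn) n (signedQ k n))
        (alternant X (fun i => C (cyclicWeight n hn i)) (betaNumber p.1)) := by
  rw [alternantClass, schubert, Fintype.linearCombination_apply_single, one_smul]

lemma schurClass_schubert (hn : 0 < n) (p : BoxPartition k n) :
    schurClass k n (cyclicWeight n hn) (signedQ k n) (schubert p) =
      Ideal.Quotient.mkₐ (Polynomial (TorusRing n)) (quantumIdeal k (cyclicWeight n hn) n (signedQ k n))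
        (tabSum X (fun i => C (cyclicWeight n hn i)) p.1) := by
  rw [schurClass, schubert, Fintype.linearCombination_apply_single, one_smul]

/-- Modulo `(x_i|t)^n = (-1)^{k-1} q`, rim hook reduction does not change alternants. -/
lemma IsRimHookImage.alternantClass_eq (hk : 0 < k) (hkn : k ≤ n) (hn : 0 < n) {g : Fin k → ℕ}
    (hg : Antitone g) {v : QModule k n} (hv : IsRimHookImage n g v) :
    alternantClass k n (cyclicWeight n hn) (signedQ k n) v =
      Ideal.Quotient.mkₐ (Polynomial (TorusRing n)) (quantumIdeal k (cyclicWeight n hn) n (signedQ k n))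
        (alternant X (fun i => C (cyclicWeight n hn i)) (betaNumber g)) := by
  obtain ⟨es, p, hred, hcore, rfl⟩ := hv
  have H := facPow_mk_add (k := k) (cyclicWeight_add hn) (signedQ k n)
  have hp := hred.antitone hg
  rw [mk_alternant, hred.alternant_eq H, map_smul]
  by_cases hbox : ∀ i, p i ≤ n - k
  · obtain ⟨p, rfl⟩ : ∃ p' : BoxPartition k n, p'.1 = p := ⟨⟨p, hp, hbox⟩, rfl⟩
    have hs : schubertOrZero n p.1 = schubert p := dif_pos p.2
    rw [hs, alternantClass_schubert, mk_alternant]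
    exact prod_sign_smul (R := Polynomial (TorusRing n)) (B := MvPolynomial (Fin k)
      (Polynomial (TorusRing n)) ⧸ quantumIdeal k (cyclicWeight n hn) n (signedQ k n)) es k _ _
  · have hs : schubertOrZero (k := k) n p = 0 := dif_neg fun h => hbox h.2
    rw [hs, map_zero, smul_zero, hcore.alternant_eq_zero H hn hk hkn hp hbox, mul_zero]

/-- Rim hook reduction is defined on every Schubert class, and does not depend on choices. -/
theorem existsUnique_isRimHookImage (hk : 0 < k) (hkn : k ≤ n) {g : Fin k → ℕ} (hg : Antitone g) :
    ∃! v : QModule k n, IsRimHookImage n g v := by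
  have hn : 0 < n := hk.trans_le hkn
  obtain ⟨es, q, h1, h2⟩ := exists_rimHookReduces hn hg
  refine ⟨_, ⟨es, q, h1, h2, rfl⟩, fun v hv => ?_⟩
  refine alternantClass_injective hn hkn (cyclicWeight n hn) (signedQ k n) ?_
  rw [hv.alternantClass_eq hk hkn hn hg, IsRimHookImage.alternantClass_eq hk hkn hn hg
    ⟨es, q, h1, h2, rfl⟩]

lemma alternantClass_phiClass (hk : 0 < k) (hkn : k ≤ n) (hn : 0 < n) {g : Fin k → ℕ}
    (hg : Antitone g) :
    alternantClass k n (cyclicWeight n hn) (signedQ k n) (phiClass n g) =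
      Ideal.Quotient.mkₐ (Polynomial (TorusRing n)) (quantumIdeal k (cyclicWeight n hn) n (signedQ k n))
        (alternant X (fun i => C (cyclicWeight n hn i)) (betaNumber g)) :=
  IsRimHookImage.alternantClass_eq hk hkn hn hg
    (Classical.epsilon_spec (existsUnique_isRimHookImage hk hkn hg).exists)

lemma sum_smul_tabSum_map {R R' : Type*} [CommRing R] [CommRing R'] (φ : R →+* R') {N : ℕ}
    {w : ℕ → R} {u : ℕ → R'} (h : ∀ i < N, φ (w i) = u i) {c : BoxPartition k N → R}
    {a b : BoxPartition k N}
    (hc : tabSum X (fun i => C (w i)) a.1 * tabSum X (fun i => C (w i)) b.1 =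
      ∑ g, c g • tabSum X (fun i => C (w i)) g.1) :
    tabSum X (fun i => C (u i)) a.1 * tabSum X (fun i => C (u i)) b.1 =
      ∑ g, φ (c g) • tabSum X (fun i => C (u i)) g.1 := by
  have hmap : ∀ g : BoxPartition k N,
      map φ (tabSum X (fun i => C (w i)) g.1) = tabSum X (fun i => C (u i)) g.1 := fun g => by
    rw [map_tabSum]
    simp only [map_X, map_C]
    exact tabSum_congr _ (fun i hi => by rw [h i hi]) g
  have h' := congrArg (map φ) hc
  simpa only [map_mul, map_sum, smul_eq_C_mul, map_C, hmap] using h'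

lemma phiCoeff_weight (hn : 0 < n) {i : ℕ} (hi : i < 2 * n - 1) :
    phiCoeff n (weight (2 * n - 1) i) = cyclicWeight n hn i := by
  simp [phiCoeff, weight, hi, cyclicWeight]

lemma alternantClass_circBasis (hk : 0 < k) (hkn : k < n) (hn : 0 < n) (a b : BoxPartition k n) :
    alternantClass k n (cyclicWeight n hn) (signedQ k n) (circBasis a b) =
      schurClass k n (cyclicWeight n hn) (signedQ k n) (schubert a) *
        alternantClass k n (cyclicWeight n hn) (signedQ k n) (schubert b) := by
  have h := sum_smul_tabSum_map (a := a.lift) (b := b.lift) (phiCoeff n)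
    (fun i hi => phiCoeff_weight hn hi) (tabSum_mul_tabSum_eq_sum hk hkn a b)
  rw [circBasis, map_sum, alternantClass_eq _ _ (schubert b), schurClass_schubert,
    schurClass_schubert, ← map_mul, ← map_mul, ← mul_assoc]
  rw [show tabSum X (fun i => C (cyclicWeight n hn i)) a.1 *
    tabSum X (fun i => C (cyclicWeight n hn i)) b.1 = _ from h, sum_mul, map_sum]
  refine sum_congr rfl fun g _ => ?_
  rw [map_smul, alternantClass_phiClass hk hkn.le hn g.2.1, smul_mul_assoc,
    tabSum_mul_alternant _ _ _ g.2.1, map_smul]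

/-- In the quotient, `∘` becomes multiplication of symmetric polynomials acting on alternants. -/
lemma alternantClass_circ (hk : 0 < k) (hkn : k < n) (hn : 0 < n) (u v : QModule k n) :
    alternantClass k n (cyclicWeight n hn) (signedQ k n) (circ u v) =
      schurClass k n (cyclicWeight n hn) (signedQ k n) u *
        alternantClass k n (cyclicWeight n hn) (signedQ k n) v := by
  have hu : u = ∑ a, u a • schubert a := by
    simpa [schubert, ← Pi.single_smul] using (univ_sum_single u).symm
  have hv : v = ∑ b, v b • schubert b := by
    simpa [schubert, ← Pi.single_smul] using (univ_sum_single v).symm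
  conv_rhs => rw [hu, hv]
  simp only [circ, map_sum, map_smul, sum_mul_sum, alternantClass_circBasis hk hkn hn,
    smul_mul_smul_comm]

theorem circ_assoc (hk : 0 < k) (hkn : k < n) (u v w : QModule k n) :
    circ (circ u v) w = circ u (circ v w) := by
  have hn : 0 < n := hk.trans hkn
  refine alternantClass_injective hn hkn.le (cyclicWeight n hn) (signedQ k n) ?_
  have h := alternantClass_circ hk hkn hn
  rw [h (circ u v) w, alternantClass_eq _ _ w, mul_left_comm, ← alternantClass_eq, h u v,
    h u (circ v w), h v w, alternantClass_eq _ _ v, alternantClass_eq _ _ w]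
  ring

end Product

end GrassRimHook

open GrassRimHook in
/-- Well-definedness of the two ingredients of `∘`, and one-box associativity. -/
theorem proposition3p3 (k n : ℕ) (hk : 0 < k) (hkn : k < n) :
    (∀ a b : BoxPartition k (2 * n - 1), ∃! c, IsProductExpansion a b c) ∧
    (∀ g : BoxPartition k (2 * n - 1), ∃! v : QModule k n, IsRimHookImage n g.1 v) ∧
    ∀ a b : BoxPartition k n,
      circ (circ (schubert (box hkn)) (schubert a)) (schubert b) =
        circ (schubert (box hkn)) (circ (schubert a) (schubert b)) :=
  ⟨existsUnique_isProductExpansion hk (by omega),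
    fun g => existsUnique_isRimHookImage hk hkn.le g.2.1,
    fun _ _ => circ_assoc hk hkn _ _ _⟩
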